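/- Conventions. Links are unoriented links in $S^3$ up to isotopy, given by diagrams. Let $t$ be a finite plane rooted tree (with at least one vertex) with integer weights on its vertices. A weight $w$ stands for a twist region with $|w|$ crossings; a crossing is called positive if its strand from the bottom left to the top right passes over, and the crossings of the twist region have the sign of $w$. The root is a horizontal twist region (for $w=0$: two horizontal lines); the tangles of the subtrees at its children, whose roots are vertical twist regions, are attached to it from left to right in the order of the plane tree. Likewise, the tangles of the subtrees at the children of a vertical twist region, whose roots are again horizontal twist regions, are attached below it from top to bottom; and so on. The arborescent link of $t$ is obtained from the resulting tangle with four end points by joining the two top end points and the two bottom end points. The elements of the Thompson group $F$ are represented by pairs $(T_+,T_-)$ of finite rooted binary plane trees with equal numbers of leaves, up to additions and deletions of pairs of opposing carets, with product $(T_+,T)\cdot(T,T_-)=(T_+,T_-)$. The positive monoid $F_+$ is generated by the standard generators $x_0,x_1,x_2,\dots$, where $x_n$ is represented by the pair whose bottom tree is the right comb with $n+3$ leaves, and whose top tree is the right comb with $n+1$ leaves with one caret added at its last leaf and another one at the left leaf of that caret. To a pair $(T_+,T_-)$ with $n$ leaves Jones associates a link: draw $T_+$ in the upper half-plane with its leaves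 at $1,\dots,n$ on the $x$-axis, add to every trivalent vertex a strand running from it down to the $x$-axis between the leaves of its left and of its right subtree, extend the edge above the root to the point $0$ of the $x$-axis, turn each resulting $4$-valent vertex into a crossing in which the arc through the left and the right edge passes over, and glue the result to the tangle of $T_-$, drawn in the same way upside down in the lower half-plane. The link of an element of $F$ is that of the reduced pair representing it; the links of the elements of $F_+$ are called positive Thompson links. Statement. The arborescent link of every weighted plane rooted tree all of whose weights are strictly positive is a positive Thompson link. -/

import Mathlib

/-! ## Link diagrams and links

An unoriented tangle diagram in the plane is recorded, as usual, by cutting it into horizontal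
slices.  Reading from top to bottom, every slice contains exactly one local maximum, local minimum
or crossing, next to a number of vertical strands, and is given by the kind of the event and the
number of vertical strands to its left.  Links are diagrams without end points, up to the standard
moves: planar isotopy (exchange of heights, straightening of a strand, rotation of a crossing) and
the three Reidemeister moves. -/

namespace Knot

/-- The events in a slice: a local maximum `∩`, a local minimum `∪`, a crossing whose strand from
the bottom left to the top right passes over (`pos`), and a crossing whose strand from the bottom
left to the top right passes under (`neg`). -/
inductive Event
  | cap
  | cup
  | pos
  | neg

/-- The number of strands above the event. -/
def Event.inp : Event → ℕ
  | cap => 0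
  | cup => 2
  | pos => 2
  | neg => 2

/-- The number of strands below the event. -/
def Event.out : Event → ℕ
  | cap => 2
  | cup => 0
  | pos => 2
  | neg => 2

/-- A list of slices, from top to bottom; the slice `(e, i)` is the event `e` with `i` vertical
strands to its left. -/
abbrev Word := List (Event × ℕ)

/-- `IsTangle w n m`: the word `w` is a tangle diagram with `n` end points at the top and `m` end
points at the bottom. -/
inductive IsTangle : Word → ℕ → ℕ → Prop
  | nil (n : ℕ) : IsTangle [] n n
  | cons {e : Event} {i r n m : ℕ} {w : Word} (h : n = i + e.inp + r)
      (hw : IsTangle w (i + e.out + r) m) : IsTangle ((e, i) :: w) n m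

/-- A link diagram: a tangle diagram without end points. -/
structure LinkDiagram where
  word : Word
  closed : IsTangle word 0 0

/-- The local moves on tangle diagrams. -/
inductive LocalMove : Word → Word → Prop
  /-- two distant events exchange their heights -/
  | exchange (e f : Event) (i k : ℕ) :
      LocalMove [(e, i), (f, i + e.out + k)] [(f, i + e.inp + k), (e, i)]
  /-- straightening of a strand -/
  | zigzag (i : ℕ) : LocalMove [(.cap, i), (.cup, i + 1)] []
  | zagzig (i : ℕ) : LocalMove [(.cap, i + 1), (.cup, i)] []
  /-- a strand below or above a local maximum moves from one of its sides to the other -/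
  | capSlideUnder (i : ℕ) : LocalMove [(.cap, i), (.neg, i + 1)] [(.cap, i + 1), (.pos, i)]
  | capSlideOver (i : ℕ) : LocalMove [(.cap, i), (.pos, i + 1)] [(.cap, i + 1), (.neg, i)]
  /-- a strand below or above a local minimum moves from one of its sides to the other -/
  | cupSlideUnder (i : ℕ) : LocalMove [(.pos, i + 1), (.cup, i)] [(.neg, i), (.cup, i + 1)]
  | cupSlideOver (i : ℕ) : LocalMove [(.neg, i + 1), (.cup, i)] [(.pos, i), (.cup, i + 1)]
  /-- the first Reidemeister move -/
  | capCurlPos (i : ℕ) : LocalMove [(.cap, i), (.pos, i)] [(.cap, i)]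
  | capCurlNeg (i : ℕ) : LocalMove [(.cap, i), (.neg, i)] [(.cap, i)]
  | cupCurlPos (i : ℕ) : LocalMove [(.pos, i), (.cup, i)] [(.cup, i)]
  | cupCurlNeg (i : ℕ) : LocalMove [(.neg, i), (.cup, i)] [(.cup, i)]
  /-- the second Reidemeister move -/
  | posNeg (i : ℕ) : LocalMove [(.pos, i), (.neg, i)] []
  | negPos (i : ℕ) : LocalMove [(.neg, i), (.pos, i)] []
  /-- the third Reidemeister move -/
  | braid (i : ℕ) :
      LocalMove [(.pos, i), (.pos, i + 1), (.pos, i)] [(.pos, i + 1), (.pos, i), (.pos, i + 1)]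

/-- Two link diagrams differ by one local move. -/
def Move (D D' : LinkDiagram) : Prop :=
  ∃ u v a b : Word, LocalMove a b ∧ D.word = u ++ a ++ v ∧ D'.word = u ++ b ++ v

/-- Unoriented links up to isotopy: link diagrams modulo the equivalence relation generated by the
local moves. -/
def Link : Type := Quot Move

/-- The link of a diagram. -/
def LinkDiagram.link (D : LinkDiagram) : Link := Quot.mk Move D

/-! ### Operations on diagrams -/

/-- Move a diagram to the right, past `k` vertical strands. -/
def Word.shift (k : ℕ) (w : Word) : Word := w.map fun s => (s.1, k + s.2)

/-- The effect on an event of the reflection of the plane in a horizontal line. -/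
def Event.flip : Event → Event
  | cap => cup
  | cup => cap
  | pos => neg
  | neg => pos

/-- The reflection of a diagram in a horizontal line of the plane of projection; overpasses stay
overpasses. -/
def Word.flip (w : Word) : Word := (w.map fun s => (s.1.flip, s.2)).reverse

theorem IsTangle.append {u v : Word} {n m l : ℕ} (hu : IsTangle u n m) (hv : IsTangle v m l) :
    IsTangle (u ++ v) n l := by
  induction hu with
  | nil => exact hv
  | cons h _ ih => exact .cons h (ih hv)

theorem IsTangle.shift {w : Word} {n m : ℕ} (hw : IsTangle w n m) (k r : ℕ) :
    IsTangle (Word.shift k w) (k + n + r) (k + m + r) := by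
  induction hw with
  | nil => exact .nil _
  | @cons e i s n m w h _ ih =>
    have h' : k + n + r = k + i + e.inp + (s + r) := by omega
    refine IsTangle.cons (r := s + r) h' ?_
    have : k + i + e.out + (s + r) = k + (i + e.out + s) + r := by omega
    rw [this]
    exact ih

theorem IsTangle.flip {w : Word} {n m : ℕ} (hw : IsTangle w n m) :
    IsTangle (Word.flip w) m n := by
  induction hw with
  | nil => exact .nil _
  | @cons e i r n m w h _ ih =>
    have h1 : IsTangle [(e.flip, i)] (i + e.out + r) n := by
      refine .cons (r := r) (by cases e <;> rfl) ?_
      have : i + e.flip.out + r = n := by subst h; cases e <;> rfl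
      rw [this]
      exact .nil _
    have := ih.append h1
    simpa [Word.flip] using this

/-! ### Tangles with four end points -/

/-- The tangle sum: `a` and `b` side by side, the two right end points of `a` joined to the two
left end points of `b`. -/
def hSum (a b : Word) : Word := (.cap, 1) :: (a ++ Word.shift 2 b ++ [(.cup, 1)])

/-- The tangle consisting of two horizontal lines. -/
def twoHorizontalLines : Word := [(.cup, 0), (.cap, 0)]

/-- A crossing of the given sign: in a positive crossing the strand going from the bottom left to
the top right passes over. -/
def crossing (w : ℤ) : Word := if 0 < w then [(.pos, 0)] else [(.neg, 0)]

/-- The horizontal twist region with `|w|` crossings of the sign of `w`. -/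
def hTwist (w : ℤ) : Word := (hSum (crossing w))^[w.natAbs] twoHorizontalLines

/-- The vertical twist region with `|w|` crossings of the sign of `w`. -/
def vTwist (w : ℤ) : Word := (List.replicate w.natAbs (crossing w)).flatten

/-- The closure of a tangle with four end points that joins the two end points at the top and the
two end points at the bottom. -/
def closureWord (a : Word) : Word := (.cap, 0) :: (a ++ [(.cup, 0)])

theorem IsTangle.hSum {a b : Word} (ha : IsTangle a 2 2) (hb : IsTangle b 2 2) :
    IsTangle (Knot.hSum a b) 2 2 := by
  refine .cons (r := 1) rfl ?_
  have h1 : IsTangle a 4 4 := by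
    have := ha.shift 0 2
    simpa [Word.shift] using this
  have h2 : IsTangle (Word.shift 2 b) 4 4 := hb.shift 2 0
  exact (h1.append h2).append (.cons (r := 1) rfl (.nil _))

theorem isTangle_twoHorizontalLines : IsTangle twoHorizontalLines 2 2 :=
  .cons (r := 0) rfl (.cons (r := 0) rfl (.nil _))

theorem isTangle_crossing (w : ℤ) : IsTangle (crossing w) 2 2 := by
  unfold crossing
  split_ifs <;> exact .cons (r := 0) rfl (.nil _)

theorem isTangle_hTwist (w : ℤ) : IsTangle (hTwist w) 2 2 := by
  unfold hTwist
  induction w.natAbs with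
  | zero => exact isTangle_twoHorizontalLines
  | succ k ih =>
    rw [Function.iterate_succ_apply']
    exact (isTangle_crossing w).hSum ih

theorem isTangle_vTwist (w : ℤ) : IsTangle (vTwist w) 2 2 := by
  unfold vTwist
  induction w.natAbs with
  | zero => exact .nil _
  | succ k ih =>
    rw [List.replicate_succ, List.flatten_cons]
    exact (isTangle_crossing w).append ih

theorem isTangle_closureWord {a : Word} (ha : IsTangle a 2 2) : IsTangle (closureWord a) 0 0 :=
  .cons (r := 0) rfl (ha.append (.cons (r := 0) rfl (.nil _)))

/-! ## Arborescent links -/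

/-- Finite rooted plane trees with integer weights on the vertices: a vertex has a weight and a
linearly ordered list of subtrees. -/
inductive WeightedTree
  | node (weight : ℤ) (children : List WeightedTree)

/-- All weights of the tree are strictly positive. -/
inductive WeightedTree.AllPositive : WeightedTree → Prop
  | node {w : ℤ} {ts : List WeightedTree} (hw : 0 < w) (hts : ∀ t ∈ ts, AllPositive t) :
      AllPositive (.node w ts)

mutual

/-- The tangle of a tree whose root is a horizontal twist region: to that region, the tangles of
the subtrees, whose roots are vertical twist regions, are attached from left to right. -/
def WeightedTree.hTangle : WeightedTree → Word
  | .node w ts => hSum (hTwist w) (WeightedTree.hAttach ts)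

/-- The tangles of the given trees, with vertical twist regions at the roots, side by side. -/
def WeightedTree.hAttach : List WeightedTree → Word
  | [] => twoHorizontalLines
  | t :: ts => hSum t.vTangle (WeightedTree.hAttach ts)

/-- The tangle of a tree whose root is a vertical twist region: to that region, the tangles of
the subtrees, whose roots are horizontal twist regions, are attached from top to bottom. -/
def WeightedTree.vTangle : WeightedTree → Word
  | .node w ts => vTwist w ++ WeightedTree.vAttach ts

/-- The tangles of the given trees, with horizontal twist regions at the roots, below each
other. -/
def WeightedTree.vAttach : List WeightedTree → Word
  | [] => []
  | t :: ts => t.hTangle ++ WeightedTree.vAttach ts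

end

mutual

theorem WeightedTree.isTangle_hTangle : (t : WeightedTree) → IsTangle t.hTangle 2 2
  | .node w ts => by
    rw [WeightedTree.hTangle]
    exact (isTangle_hTwist w).hSum (WeightedTree.isTangle_hAttach ts)

theorem WeightedTree.isTangle_hAttach :
    (ts : List WeightedTree) → IsTangle (WeightedTree.hAttach ts) 2 2
  | [] => by
    rw [WeightedTree.hAttach]
    exact isTangle_twoHorizontalLines
  | t :: ts => by
    rw [WeightedTree.hAttach]
    exact (WeightedTree.isTangle_vTangle t).hSum (WeightedTree.isTangle_hAttach ts)

theorem WeightedTree.isTangle_vTangle : (t : WeightedTree) → IsTangle t.vTangle 2 2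
  | .node w ts => by
    rw [WeightedTree.vTangle]
    exact (isTangle_vTwist w).append (WeightedTree.isTangle_vAttach ts)

theorem WeightedTree.isTangle_vAttach :
    (ts : List WeightedTree) → IsTangle (WeightedTree.vAttach ts) 2 2
  | [] => by
    rw [WeightedTree.vAttach]
    exact .nil _
  | t :: ts => by
    rw [WeightedTree.vAttach]
    exact (WeightedTree.isTangle_hTangle t).append (WeightedTree.isTangle_vAttach ts)

end

/-- The arborescent link of a weighted plane rooted tree: the closure of its arborescent tangle,
in which the root is a horizontal twist region. -/
def arborescentLink (t : WeightedTree) : Link :=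
  LinkDiagram.link ⟨closureWord t.hTangle, isTangle_closureWord t.isTangle_hTangle⟩

/-- The arborescent links of the weighted plane rooted trees with strictly positive weights. -/
def positiveArborescentLinks : Set Link := {L | ∃ t : WeightedTree, t.AllPositive ∧
  arborescentLink t = L}

/-! ## The Thompson group `F` -/

/-- Finite rooted binary plane trees. -/
abbrev BinTree := BinaryTree Unit

/-- Add a caret below the leaf number `i`; the leaves are numbered `0, 1, 2, …` from left to
right. -/
def addCaret : BinTree → ℕ → BinTree
  | .nil, _ => .node () .nil .nil
  | .node _ l r, i =>
    if i < l.numLeaves then .node () (addCaret l i) r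
    else .node () l (addCaret r (i - l.numLeaves))

/-- A pair of finite rooted binary plane trees with equal numbers of leaves. -/
structure TreePair where
  top : BinTree
  bottom : BinTree
  numLeaves_eq : top.numLeaves = bottom.numLeaves

/-- `q` arises from `p` by the addition of a pair of opposing carets. -/
def TreePair.AddCarets (p q : TreePair) : Prop :=
  ∃ i < p.top.numLeaves, q.top = addCaret p.top i ∧ q.bottom = addCaret p.bottom i

/-- The pair of trees has no pair of opposing carets. -/
def TreePair.IsReduced (p : TreePair) : Prop := ¬ ∃ q : TreePair, q.AddCarets p

/-- The elements of the Thompson group `F`: pairs of trees up to additions and deletions of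
opposing carets.  The product in `F` is `(A, B) * (B, C) = (A, C)`. -/
def ThompsonF : Type := Quot TreePair.AddCarets

/-- The element of `F` represented by a pair of trees. -/
def TreePair.toF (p : TreePair) : ThompsonF := Quot.mk TreePair.AddCarets p

/-- The tree with `n` carets, each of them attached to the right leaf of the previous one. -/
def rightComb : ℕ → BinTree
  | 0 => .nil
  | n + 1 => .node () .nil (rightComb n)

/-- The top tree of the generator `x n`: the tree `rightComb n`, with two carets added at its last
leaf, the second one below the left leaf of the first. -/
def generatorTop : ℕ → BinTree
  | 0 => .node () (.node () .nil .nil) .nil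
  | n + 1 => .node () .nil (generatorTop n)

theorem numLeaves_generatorTop (n : ℕ) :
    (generatorTop n).numLeaves = (rightComb (n + 2)).numLeaves := by
  induction n with
  | zero => rfl
  | succ n ih => simpa [generatorTop, rightComb] using ih

/-- The standard generator `x n` of `F`, as a pair of trees. -/
def generator (n : ℕ) : TreePair := ⟨generatorTop n, rightComb (n + 2), numLeaves_generatorTop n⟩

/-- The positive monoid `F₊`: the submonoid of `F` generated by `x 0, x 1, x 2, …`. -/
inductive IsPositive : ThompsonF → Prop
  | one (T : BinTree) : IsPositive (TreePair.toF ⟨T, T, rfl⟩)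
  | generator (n : ℕ) : IsPositive (generator n).toF
  | mul {A B C : BinTree} (hAB : A.numLeaves = B.numLeaves) (hBC : B.numLeaves = C.numLeaves)
      (h : IsPositive (TreePair.toF ⟨A, B, hAB⟩)) (h' : IsPositive (TreePair.toF ⟨B, C, hBC⟩)) :
      IsPositive (TreePair.toF ⟨A, C, hAB.trans hBC⟩)

/-! ## Thompson links -/

/-- The diagram below the root edge of a binary tree in the upper half-plane.  Every trivalent
vertex has become a crossing of an arc, through its left and its right foot, with a strand that
passes under the arc, from the edge above the vertex down to the ground between the leaves of the
left subtree and those of the right subtree.  The end points at the bottom are the leaves and, in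
between, the lower ends of these strands. -/
def branchWord : BinTree → Word
  | .nil => []
  | .node _ l r => (.cap, 0) :: (.neg, 1) ::
      (branchWord l ++ Word.shift (2 * l.numNodes + 2) (branchWord r))

/-- The tangle of a binary tree in the upper half-plane: the strand sprouting from the root is
extended until it meets the ground to the left of all leaves. -/
def treeWord (T : BinTree) : Word := (.cap, 0) :: Word.shift 1 (branchWord T)

theorem isTangle_branchWord (T : BinTree) : IsTangle (branchWord T) 1 (2 * T.numNodes + 1) := by
  induction T with
  | nil => exact .nil _
  | node _ l r ihl ihr =>
    refine .cons (r := 1) rfl (.cons (r := 0) rfl ?_)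
    have h1 : IsTangle (branchWord l) 3 (2 * l.numNodes + 3) := by
      have := ihl.shift 0 2
      simpa [Word.shift] using this
    have h2 : IsTangle (Word.shift (2 * l.numNodes + 2) (branchWord r)) (2 * l.numNodes + 3)
        (2 * (l.numNodes + r.numNodes + 1) + 1) := by
      have := ihr.shift (2 * l.numNodes + 2) 0
      have e : 2 * l.numNodes + 2 + (2 * r.numNodes + 1) + 0
          = 2 * (l.numNodes + r.numNodes + 1) + 1 := by ring
      rwa [e] at this
    exact h1.append h2

theorem isTangle_treeWord (T : BinTree) : IsTangle (treeWord T) 0 (2 * T.numLeaves) := by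
  refine .cons (r := 0) rfl ?_
  have := (isTangle_branchWord T).shift 1 0
  have e : 1 + (2 * T.numNodes + 1) + 0 = 2 * T.numLeaves := by
    rw [T.numLeaves_eq_numNodes_succ]; ring
  rwa [e] at this

/-- The link of a pair of trees: the tangle of the top tree in the upper half-plane, glued to the
tangle of the bottom tree in the lower half-plane, which is drawn upside down. -/
def thompsonLink (p : TreePair) : Link :=
  LinkDiagram.link ⟨treeWord p.top ++ Word.flip (treeWord p.bottom),
    (isTangle_treeWord p.top).append (p.numLeaves_eq ▸ (isTangle_treeWord p.bottom).flip)⟩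

/-- The positive Thompson links: the links of the positive elements of `F`, where the link of an
element is read off from the reduced pair of trees that represents it. -/
def positiveThompsonLinks : Set Link := {L | ∃ p : TreePair, p.IsReduced ∧ IsPositive p.toF ∧
  thompsonLink p = L}

end Knot

/-!
The link of a pair of trees whose bottom tree is a right comb is assembled from tangles with four
end points. Write `0` and `∞` for two horizontal and two vertical lines, `1` and `-1` for the
positive and the negative crossing, `+` for the tangle sum, and `R` for the clockwise rotation by a
quarter turn. Every binary tree has a tangle `treeTangle`, defined by `f nil = 0` and
`f (node l r) = 1 + R (f l) + f r`, and the link of the pair of `node T nil` and a right comb is the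
closure of `f T` (`diagram_iso_closureWord`). The right comb is what makes this recursion work: it
splits along the branches of the top tree (`graft_node`). The recursion that one reads off directly
has a crossing on top of `f l` in place of a rotation, and the two forms agree because a strand can
be slid below a whole tangle (`Iso.underpass_word`, `Iso.pos_append_hSum_neg`).

The tangles `f T`, here called realizable, contain `0` and are closed under `b ↦ 1 + b`, because
`R ∞ = 0` and `∞ = f (node nil nil)`. They are also closed under `b ↦ (-1) + b`: the vertical
composite of two positive crossings is realizable, its rotation is `-2`, and `1 - 2 = -1`
(`Realizable.neg_hSum`). With both crossings at hand, they are closed under `(a, b) ↦ R a + b`.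
A vertical composite is a rotated sum and `R` has order four on expressions, so by induction all
algebraic tangles are realizable (`AlgTangle.realizable`), in particular the arborescent ones.

Every pair with a right comb at the bottom lies in the positive monoid, as adding a caret to the top
tree multiplies by a generator (`isPositive_rightComb`). The pair of `node T nil` and a right comb
is reduced as soon as `T` has a caret, and `T` may be chosen so since `f T = 1 + (-1 + f T)`
(`Realizable.exists_ne_nil`).
-/

namespace Knot

/-! ### Isotopies of tangle diagrams -/

@[simp]
theorem Event.inp_cap : Event.cap.inp = 0 := rfl

@[simp]
theorem Event.inp_cup : Event.cup.inp = 2 := rfl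

@[simp]
theorem Event.inp_pos : Event.pos.inp = 2 := rfl

@[simp]
theorem Event.inp_neg : Event.neg.inp = 2 := rfl

@[simp]
theorem Event.out_cap : Event.cap.out = 2 := rfl

@[simp]
theorem Event.out_cup : Event.cup.out = 0 := rfl

@[simp]
theorem Event.out_pos : Event.pos.out = 2 := rfl

@[simp]
theorem Event.out_neg : Event.neg.out = 2 := rfl

@[simp]
theorem isTangle_nil_iff {n m : ℕ} : IsTangle [] n m ↔ n = m :=
  ⟨fun h => by cases h; rfl, fun h => h ▸ .nil n⟩

@[simp]
theorem isTangle_cons_iff {e : Event} {i n m : ℕ} {w : Word} :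
    IsTangle ((e, i) :: w) n m ↔ i + e.inp ≤ n ∧ IsTangle w (n - e.inp + e.out) m := by
  constructor
  · rintro (_ | @⟨_, _, r, _, _, _, h, hw⟩)
    refine ⟨by omega, ?_⟩
    have : n - e.inp + e.out = i + e.out + r := by omega
    rwa [this]
  · rintro ⟨h, hw⟩
    refine .cons (r := n - e.inp - i) (by omega) ?_
    have : i + e.out + (n - e.inp - i) = n - e.inp + e.out := by omega
    rwa [this]

theorem IsTangle.of_eq {w : Word} {n m n' m' : ℕ} (h : IsTangle w n m) (hn : n = n') (hm : m = m') :
    IsTangle w n' m' := hn ▸ hm ▸ h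

theorem isTangle_append_iff {u v : Word} {n m : ℕ} :
    IsTangle (u ++ v) n m ↔ ∃ k, IsTangle u n k ∧ IsTangle v k m := by
  constructor
  · intro h
    induction u generalizing n with
    | nil => exact ⟨n, .nil n, h⟩
    | cons s u ih =>
      obtain ⟨e, i⟩ := s
      obtain ⟨h1, h2⟩ := isTangle_cons_iff.1 h
      obtain ⟨k, hk, hv⟩ := ih h2
      exact ⟨k, isTangle_cons_iff.2 ⟨h1, hk⟩, hv⟩
  · rintro ⟨k, hu, hv⟩
    exact hu.append hv

/-- A local move can be read from left to right in every width. From right to left this fails for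
the moves that create events, which need enough strands. -/
theorem LocalMove.isTangle {x y : Word} (h : LocalMove x y) {n m : ℕ} (hx : IsTangle x n m) :
    IsTangle y n m := by
  cases h with
  | exchange e f i k =>
    simp only [isTangle_cons_iff, isTangle_nil_iff] at hx ⊢
    omega
  | _ =>
    simp only [isTangle_cons_iff, isTangle_nil_iff, Event.inp, Event.out] at hx ⊢
    omega

@[simp]
theorem Word.shift_nil (k : ℕ) : Word.shift k [] = [] := rfl

@[simp]
theorem Word.shift_cons (k i : ℕ) (e : Event) (w : Word) :
    Word.shift k ((e, i) :: w) = (e, k + i) :: Word.shift k w := rfl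

@[simp]
theorem Word.shift_append (k : ℕ) (u v : Word) :
    Word.shift k (u ++ v) = Word.shift k u ++ Word.shift k v := List.map_append

@[simp]
theorem Word.shift_shift (k l : ℕ) (w : Word) :
    Word.shift k (Word.shift l w) = Word.shift (k + l) w := by
  simp [Word.shift, Nat.add_assoc]

@[simp]
theorem Word.shift_zero (w : Word) : Word.shift 0 w = w := by
  simp [Word.shift]

theorem LocalMove.shift {x y : Word} (h : LocalMove x y) (k : ℕ) :
    LocalMove (Word.shift k x) (Word.shift k y) := by
  cases h with
  | exchange e f i l =>
    simp only [Word.shift_cons, Word.shift_nil, ← Nat.add_assoc]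
    exact .exchange e f (k + i) l
  | _ => constructor

/-- One local move inside a tangle diagram. -/
def TangleMove (n m : ℕ) (a b : Word) : Prop :=
  IsTangle a n m ∧ IsTangle b n m ∧
    ∃ u v x y : Word, LocalMove x y ∧ a = u ++ x ++ v ∧ b = u ++ y ++ v

/-- Isotopy of tangle diagrams with `n` end points at the top and `m` at the bottom: every
intermediate diagram is a tangle diagram with the same end points. -/
def Iso (n m : ℕ) : Word → Word → Prop := Relation.EqvGen (TangleMove n m)

namespace Iso

variable {n m k l : ℕ} {a b c x y : Word}

@[refl]
theorem refl (a : Word) : Iso n m a a := Relation.EqvGen.refl a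

@[symm]
theorem symm (h : Iso n m a b) : Iso n m b a := Relation.EqvGen.symm _ _ h

theorem trans (h : Iso n m a b) (h' : Iso n m b c) : Iso n m a c :=
  Relation.EqvGen.trans _ _ _ h h'

instance : Trans (Iso n m) (Iso n m) (Iso n m) := ⟨trans⟩

theorem isTangle_iff (h : Iso n m a b) : IsTangle a n m ↔ IsTangle b n m := by
  induction h with
  | rel _ _ h => exact ⟨fun _ => h.2.1, fun _ => h.1⟩
  | refl => rfl
  | symm _ _ _ ih => exact ih.symm
  | trans _ _ _ _ _ ih ih' => exact ih.trans ih'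

theorem of_move (h : LocalMove x y) (hx : IsTangle x n m) : Iso n m x y :=
  .rel _ _ ⟨hx, h.isTangle hx, [], [], x, y, h, by simp, by simp⟩

/-- Isotopies take place inside larger diagrams. -/
theorem ctx (u v : Word) (h : Iso k l x y) (hu : IsTangle u n k) (hv : IsTangle v l m) :
    Iso n m (u ++ (x ++ v)) (u ++ (y ++ v)) := by
  induction h with
  | rel a b h =>
    obtain ⟨ha, hb, u', v', x, y, hm, rfl, rfl⟩ := h
    exact .rel _ _ ⟨hu.append (ha.append hv), hu.append (hb.append hv), u ++ u', v' ++ v, x, y, hm,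
      by simp, by simp⟩
  | refl => exact refl _
  | symm _ _ _ ih => exact ih.symm
  | trans _ _ _ _ _ ih ih' => exact ih.trans ih'

theorem append_left (u : Word) (h : Iso k m x y) (hu : IsTangle u n k) :
    Iso n m (u ++ x) (u ++ y) := by
  simpa using ctx u [] h hu (.nil m)

theorem append_right (v : Word) (h : Iso n k x y) (hv : IsTangle v k m) :
    Iso n m (x ++ v) (y ++ v) :=
  ctx [] v h (.nil n) hv

theorem shift (h : Iso n m a b) (k r : ℕ) :
    Iso (k + n + r) (k + m + r) (Word.shift k a) (Word.shift k b) := by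
  induction h with
  | rel a b h =>
    obtain ⟨ha, hb, u, v, x, y, hm, rfl, rfl⟩ := h
    exact .rel _ _ ⟨ha.shift k r, hb.shift k r, Word.shift k u, Word.shift k v, _, _, hm.shift k,
      by simp, by simp⟩
  | refl => exact refl _
  | symm _ _ _ ih => exact ih.symm
  | trans _ _ _ _ _ ih ih' => exact ih.trans ih'

/-- Isotopic link diagrams have the same link. -/
theorem link_eq {D D' : LinkDiagram} (h : Iso 0 0 D.word D'.word) : D.link = D'.link := by
  obtain ⟨a, ha⟩ := D
  obtain ⟨b, hb⟩ := D'
  change Iso 0 0 a b at h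
  induction h with
  | rel a b h =>
    obtain ⟨_, _, u, v, x, y, hm, h1, h2⟩ := h
    exact Quot.sound ⟨u, v, x, y, hm, h1, h2⟩
  | refl => rfl
  | symm _ _ _ ih => exact (ih hb ha).symm
  | trans _ _ _ h _ ih ih' => exact (ih ha ((isTangle_iff h).1 ha)).trans (ih' _ hb)

end Iso

/-- An event and a diagram to its right exchange their heights. The number of vertical strands
between them is `s`, and `r` is the number of strands on their right. -/
theorem Iso.exchange_event {b : Word} {p q : ℕ} (e : Event) (i s r : ℕ) (hb : IsTangle b p q) :
    Iso (i + e.inp + s + p + r) (i + e.out + s + q + r)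
      ((e, i) :: Word.shift (i + e.out + s) b) (Word.shift (i + e.inp + s) b ++ [(e, i)]) := by
  induction hb with
  | nil => exact .refl _
  | @cons f j t p q w h hw ih =>
    subst h
    have h1 : Iso (i + e.inp + s + (j + f.inp + t) + r) (i + e.out + s + (j + f.out + t) + r)
        [(e, i), (f, i + e.out + (s + j))] [(f, i + e.inp + (s + j)), (e, i)] := by
      apply Iso.of_move (.exchange ..)
      simp only [isTangle_cons_iff, isTangle_nil_iff]
      omega
    have h2 := h1.append_right _ (hw.shift (i + e.out + s) r)
    have h3 : IsTangle [(f, i + e.inp + (s + j))] (i + e.inp + s + (j + f.inp + t) + r)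
        (i + e.inp + s + (j + f.out + t) + r) := by
      simp only [isTangle_cons_iff, isTangle_nil_iff]
      omega
    have h4 := ih.append_left _ h3
    simpa [Nat.add_assoc] using h2.trans h4

/-- Diagrams next to each other exchange their heights. Strands between them count as part of
`a`. -/
theorem Iso.exchange {a b : Word} {n m p q : ℕ} (ha : IsTangle a n m) (hb : IsTangle b p q)
    (r : ℕ) :
    Iso (n + p + r) (m + q + r) (a ++ Word.shift m b) (Word.shift n b ++ a) := by
  induction ha with
  | nil => simpa using Iso.refl _
  | @cons e i s n m w h hw ih =>
    subst h
    have h1 : IsTangle [(e, i)] (i + e.inp + s + p + r) (i + e.out + s + p + r) := by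
      simp only [isTangle_cons_iff, isTangle_nil_iff]
      omega
    have h2 := ih.append_left _ h1
    have h3 := (Iso.exchange_event e i s r hb).append_right w
      (by simpa [Word.shift, Nat.add_assoc] using hw.shift 0 (q + r))
    simpa [Nat.add_assoc] using h2.trans (by simpa [Nat.add_assoc] using h3)

/-! ### A strand passes under a tangle -/

/-- A strand passes under `n` strands, from left to right. -/
def underpass : ℕ → Word
  | 0 => []
  | n + 1 => (.pos, 0) :: Word.shift 1 (underpass n)

theorem isTangle_underpass (n : ℕ) : IsTangle (underpass n) (n + 1) (n + 1) := by
  induction n with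
  | zero => exact .nil _
  | succ n ih =>
    refine .cons (r := n) (by simp only [Event.inp]; omega) ((ih.shift 1 0).of_eq ?_ ?_)
    · simp only [Event.out]; omega
    · omega

theorem underpass_add (n k : ℕ) :
    underpass (n + k) = underpass n ++ Word.shift n (underpass k) := by
  induction n with
  | zero => simp [underpass]
  | succ n ih =>
    rw [Nat.add_right_comm]
    simp [underpass, ih, Nat.add_comm 1]

/-- A strand passes below a single event; the four cases are the two slides, the third Reidemeister
move and its variant for the other crossing. -/
theorem Iso.underpass_event_zero (e : Event) :
    Iso (e.inp + 1) (e.out + 1) (underpass e.inp ++ [(e, 0)]) ((e, 1) :: underpass e.out) := by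
  cases e with
  | cap =>
    have h1 : Iso 1 3 [(.cap, 1), (.pos, 0), (.pos, 1)] [(.cap, 0), (.neg, 1), (.pos, 1)] :=
      (Iso.of_move (n := 1) (m := 3) (.capSlideUnder 0)
        (by simp)).symm.append_right
        [(.pos, 1)] (by simp)
    have h2 : Iso 1 3 [(.cap, 0), (.neg, 1), (.pos, 1)] [(.cap, 0)] :=
      Iso.append_left [(.cap, 0)] (Iso.of_move (n := 3) (m := 3) (.negPos 1)
        (by simp))
        (by simp)
    exact (h1.trans h2).symm
  | cup =>
    have h1 : Iso 3 1 [(.pos, 0), (.pos, 1), (.cup, 0)] [(.pos, 0), (.neg, 0), (.cup, 1)] :=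
      Iso.append_left [(.pos, 0)] (Iso.of_move (n := 3) (m := 1) (.cupSlideUnder 0)
        (by simp))
        (by simp)
    have h2 : Iso 3 1 [(.pos, 0), (.neg, 0), (.cup, 1)] [(.cup, 1)] :=
      Iso.append_right [(.cup, 1)] (Iso.of_move (n := 3) (m := 3) (.posNeg 0)
        (by simp))
        (by simp)
    exact h1.trans h2
  | pos =>
    exact Iso.of_move (.braid 0)
      (show IsTangle [(.pos, 0), (.pos, 1), (.pos, 0)] 3 3 by simp)
  | neg =>
    have h1 : Iso 3 3 [(.neg, 1), (.pos, 1), (.pos, 0), (.pos, 1), (.neg, 0)]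
        [(.pos, 0), (.pos, 1), (.neg, 0)] :=
      Iso.append_right [(.pos, 0), (.pos, 1), (.neg, 0)]
        (Iso.of_move (n := 3) (m := 3) (.negPos 1)
          (by simp))
        (by simp)
    have h2 : Iso 3 3 [(.neg, 1), (.pos, 0), (.pos, 1), (.pos, 0), (.neg, 0)]
        [(.neg, 1), (.pos, 1), (.pos, 0), (.pos, 1), (.neg, 0)] :=
      Iso.ctx [(.neg, 1)] [(.neg, 0)]
        (Iso.of_move (n := 3) (m := 3) (.braid 0)
          (by simp))
        (by simp)
        (by simp)
    have h3 : Iso 3 3 [(.neg, 1), (.pos, 0), (.pos, 1), (.pos, 0), (.neg, 0)]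
        [(.neg, 1), (.pos, 0), (.pos, 1)] :=
      Iso.append_left [(.neg, 1), (.pos, 0), (.pos, 1)]
        (Iso.of_move (n := 3) (m := 3) (.posNeg 0)
          (by simp))
        (by simp)
    exact (h1.symm.trans h2.symm).trans h3

theorem Iso.underpass_event (e : Event) (i r : ℕ) :
    Iso (i + e.inp + r + 1) (i + e.out + r + 1)
      (underpass (i + e.inp + r) ++ [(e, i)]) ((e, 1 + i) :: underpass (i + e.out + r)) := by
  have hi (s : ℕ) : IsTangle (underpass i) (i + s + 1) (i + s + 1) := by
    simpa using ((isTangle_underpass i).shift 0 s).of_eq (n' := i + s + 1) (m' := i + s + 1)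
      (by omega) (by omega)
  have hr (s : ℕ) :
      IsTangle (Word.shift (i + s) (underpass r)) (i + s + r + 1) (i + s + r + 1) := by
    simpa [Nat.add_assoc] using (isTangle_underpass r).shift (i + s) 0
  have he : IsTangle [(e, i)] (i + e.inp) (i + e.out) := by
    simp
  have he' : IsTangle [(e, 0)] e.inp e.out := by
    simp
  -- the crossings to the right of the event pass below it
  have h1 : Iso (i + e.inp + r + 1) (i + e.out + r + 1)
      (underpass (i + e.inp + r) ++ [(e, i)])
      (underpass (i + e.inp) ++ ([(e, i)] ++ Word.shift (i + e.out) (underpass r))) := by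
    rw [underpass_add (i + e.inp) r, List.append_assoc]
    refine Iso.append_left _ (k := i + e.inp + r + 1) ?_ ?_
    · simpa [Nat.add_assoc] using (Iso.exchange he (isTangle_underpass r) 0).symm
    · simpa [Nat.add_assoc, Nat.add_comm, Nat.add_left_comm] using
        (isTangle_underpass (i + e.inp)).shift 0 r
  -- the strand passes the event
  have h2 : Iso (i + e.inp + r + 1) (i + e.out + r + 1)
      (underpass i ++ (Word.shift i (underpass e.inp ++ [(e, 0)]) ++
        Word.shift (i + e.out) (underpass r)))
      (underpass i ++ (Word.shift i ((e, 1) :: underpass e.out) ++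
        Word.shift (i + e.out) (underpass r))) := by
    refine Iso.ctx _ _ ((Iso.underpass_event_zero e).shift i r) ?_ ?_
    · simpa [Nat.add_assoc, Nat.add_comm, Nat.add_left_comm] using hi (e.inp + r)
    · simpa [Nat.add_assoc, Nat.add_comm, Nat.add_left_comm] using hr e.out
  -- the crossings to the left of the event pass above it
  have h3 : Iso (i + e.inp + r + 1) (i + e.out + r + 1)
      ((underpass i ++ Word.shift (i + 1) [(e, 0)]) ++
        (Word.shift i (underpass e.out) ++ Word.shift (i + e.out) (underpass r)))
      ((Word.shift (i + 1) [(e, 0)] ++ underpass i) ++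
        (Word.shift i (underpass e.out) ++ Word.shift (i + e.out) (underpass r))) := by
    refine Iso.append_right _ (k := i + 1 + e.out + r) ?_ ?_
    · simpa [Nat.add_assoc, Nat.add_comm, Nat.add_left_comm] using
        Iso.exchange (isTangle_underpass i) he' r
    · refine IsTangle.append (m := i + e.out + r + 1) ?_ (hr e.out)
      simpa [Nat.add_assoc, Nat.add_comm, Nat.add_left_comm] using
        (isTangle_underpass e.out).shift i r
  refine h1.trans ?_
  have h4 := h2.trans (by simpa [Nat.add_comm 1] using h3)
  simpa only [underpass_add, Word.shift_append, Word.shift_cons, Word.shift_nil, List.append_assoc,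
    List.cons_append, List.nil_append, Nat.add_zero, Nat.add_comm 1] using h4

/-- A strand below a tangle diagram moves from its top to its bottom. -/
theorem Iso.underpass_word {w : Word} {n m : ℕ} (hw : IsTangle w n m) :
    Iso (n + 1) (m + 1) (underpass n ++ w) (Word.shift 1 w ++ underpass m) := by
  induction hw with
  | nil => simpa using Iso.refl _
  | @cons e i r n m w h hw ih =>
    subst h
    have h1 := (Iso.underpass_event e i r).append_right w
      (by simpa [Nat.add_comm] using hw.shift 0 1)
    have h2 : IsTangle [(e, 1 + i)] (i + e.inp + r + 1) (i + e.out + r + 1) := by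
      simp only [isTangle_cons_iff, isTangle_nil_iff]
      omega
    have h3 := ih.append_left _ h2
    simpa using (show Iso _ _ _ _ by simpa using h1).trans h3

/-! ### Moves in context and four-ended tangles -/

section

variable {n m : ℕ} {a b : Word}

theorem isTangle_det {w : Word} {n m m' : ℕ} (h : IsTangle w n m) (h' : IsTangle w n m') :
    m = m' := by
  induction w generalizing n with
  | nil => rw [isTangle_nil_iff] at h h'; omega
  | cons s w ih =>
    obtain ⟨e, i⟩ := s
    rw [isTangle_cons_iff] at h h'
    exact ih h.2 h'.2

theorem isTangle_append_of_left {u v : Word} {k : ℕ} (h : IsTangle u n k) :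
    IsTangle (u ++ v) n m ↔ IsTangle v k m := by
  rw [isTangle_append_iff]
  exact ⟨fun ⟨l, h1, h2⟩ => isTangle_det h1 h ▸ h2, fun h2 => ⟨k, h, h2⟩⟩

theorem isTangle_shift (ha : IsTangle a 2 2) {k : ℕ} (h : k + 2 ≤ n) :
    IsTangle (Word.shift k a) n n :=
  (ha.shift k (n - (k + 2))).of_eq (by omega) (by omega)

@[simp]
theorem isTangle_shift_iff (ha : IsTangle a 2 2) {k : ℕ} (h : k + 2 ≤ n) :
    IsTangle (Word.shift k a) n m ↔ n = m := by
  simpa using isTangle_append_of_left (v := []) (isTangle_shift ha h)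

@[simp]
theorem isTangle_box_iff (ha : IsTangle a 2 2) (h : 2 ≤ n) : IsTangle a n m ↔ n = m := by
  simpa using isTangle_shift_iff (n := n) (m := m) ha (k := 0) (by simpa using h)

theorem Iso.move (u v : Word) {x y : Word} (h : LocalMove x y)
    (hw : IsTangle (u ++ (x ++ v)) n m) : Iso n m (u ++ (x ++ v)) (u ++ (y ++ v)) := by
  obtain ⟨k, hu, hxv⟩ := isTangle_append_iff.1 hw
  obtain ⟨l, hx, hv⟩ := isTangle_append_iff.1 hxv
  exact ctx u v (of_move h hx) hu hv

/-- An event to the right of a four-ended tangle `a` moves above it. The hypothesis `hw`, in which a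
crossing stands for `a`, says that there are enough strands; the word with `a` itself would not do,
because `a` may be a tangle diagram already with fewer than two strands. -/
theorem Iso.box_event (u v : Word) (ha : IsTangle a 2 2) (k : ℕ) (e : Event) (i : ℕ)
    (h : k + 2 ≤ i) (hw : IsTangle (u ++ ((.pos, k) :: (e, i) :: v)) n m) :
    Iso n m (u ++ (Word.shift k a ++ (e, i) :: v)) (u ++ ((e, i) :: (Word.shift k a ++ v))) := by
  obtain ⟨N, hu, hw⟩ := isTangle_append_iff.1 hw
  simp only [isTangle_cons_iff, Event.inp_pos, Event.out_pos] at hw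
  obtain ⟨h1, h2, hv⟩ := hw
  have hs := ha.shift k (i - (k + 2))
  have he : IsTangle [(e, 0)] e.inp e.out := by simp
  have := Iso.exchange hs he (N - (i + e.inp))
  have e1 : k + 2 + (i - (k + 2)) = i := by omega
  have e2 : i + e.inp + (N - (i + e.inp)) = N := by omega
  have e3 : i + e.out + (N - (i + e.inp)) = N - 2 + 2 - e.inp + e.out := by omega
  rw [e1, e2, e3] at this
  simpa using Iso.ctx u v this hu hv

/-- An event to the left of a four-ended tangle moves above it. -/
theorem Iso.event_box (u v : Word) (ha : IsTangle a 2 2) (k l : ℕ) (e : Event) (i : ℕ)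
    (h : i + e.inp ≤ k) (hl : l = k - e.inp + e.out)
    (hw : IsTangle (u ++ ((.pos, k) :: (e, i) :: v)) n m) :
    Iso n m (u ++ (Word.shift k a ++ (e, i) :: v))
      (u ++ ((e, i) :: (Word.shift l a ++ v))) := by
  obtain ⟨N, hu, hw⟩ := isTangle_append_iff.1 hw
  simp only [isTangle_cons_iff, Event.inp_pos, Event.out_pos] at hw
  obtain ⟨h1, h2, hv⟩ := hw
  have he : IsTangle [(e, i)] k l := by
    simp only [isTangle_cons_iff, isTangle_nil_iff]; omega
  have := (Iso.exchange he ha (N - (k + 2))).symm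
  have e2 : k + 2 + (N - (k + 2)) = N := by omega
  have e3 : l + 2 + (N - (k + 2)) = N - 2 + 2 - e.inp + e.out := by omega
  rw [e2, e3] at this
  simpa using Iso.ctx u v this hu hv

theorem Iso.box_box (u v : Word) (ha : IsTangle a 2 2) (hb : IsTangle b 2 2) (k l : ℕ)
    (h : k + 2 ≤ l) (hw : IsTangle (u ++ ((.pos, l) :: v)) n m) :
    Iso n m (u ++ (Word.shift k a ++ (Word.shift l b ++ v)))
      (u ++ (Word.shift l b ++ (Word.shift k a ++ v))) := by
  obtain ⟨N, hu, hw⟩ := isTangle_append_iff.1 hw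
  simp only [isTangle_cons_iff, Event.inp_pos, Event.out_pos] at hw
  obtain ⟨h1, hv⟩ := hw
  have := Iso.exchange (ha.shift k (l - (k + 2))) hb (N - (l + 2))
  have e1 : k + 2 + (l - (k + 2)) = l := by omega
  have e2 : l + 2 + (N - (l + 2)) = N - 2 + 2 := by omega
  have e3 : N - 2 + 2 = N := by omega
  rw [e1, e2] at this
  rw [e3] at this hv
  simpa using Iso.ctx u v this hu hv

@[simp]
theorem isTangle_shift_append_iff (ha : IsTangle a 2 2) {k : ℕ} (h : k + 2 ≤ n) :
    IsTangle (Word.shift k a ++ b) n m ↔ IsTangle b n m :=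
  isTangle_append_of_left (isTangle_shift ha h)

@[simp]
theorem isTangle_box_append_iff (ha : IsTangle a 2 2) (h : 2 ≤ n) :
    IsTangle (a ++ b) n m ↔ IsTangle b n m := by
  simpa using isTangle_shift_append_iff (n := n) (m := m) (b := b) ha (k := 0) (by simpa using h)

end

section

variable {a b c a' b' : Word}

/-- The rotation of a tangle with four end points by a quarter turn, clockwise. -/
def rotate (a : Word) : Word := (.cap, 2) :: (Word.shift 1 a ++ [(.cup, 0)])

theorem IsTangle.rotate (ha : IsTangle a 2 2) : IsTangle (rotate a) 2 2 := by
  simp [Knot.rotate, ha]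

theorem Iso.hSum (h : Iso 2 2 a a') (h' : Iso 2 2 b b') (ha : IsTangle a 2 2)
    (hb' : IsTangle b' 2 2) : Iso 2 2 (hSum a b) (hSum a' b') := by
  have h1 := (h'.shift 2 0).ctx (n := 2) (m := 2)
      ((.cap, 1) :: a) [(.cup, 1)] (by simp [ha]) (by simp)
  have h2 := (h.shift 0 2).ctx (n := 2) (m := 2)
      [(.cap, 1)] (Word.shift 2 b' ++ [(.cup, 1)]) (by simp)
    (by simp [hb'])
  simpa [Knot.hSum] using h1.trans (by simpa using h2)

theorem Iso.rotate (h : Iso 2 2 a a') : Iso 2 2 (rotate a) (rotate a') := by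
  simpa [Knot.rotate] using (h.shift 1 1).ctx (n := 2) (m := 2) [(.cap, 2)] [(.cup, 0)] (by simp)
    (by simp)

theorem Iso.hSum_assoc (ha : IsTangle a 2 2) (hb : IsTangle b 2 2) (hc : IsTangle c 2 2) :
    Iso 2 2 (Knot.hSum (Knot.hSum a b) c) (Knot.hSum a (Knot.hSum b c)) := by
  unfold Knot.hSum
  calc Iso 2 2 _ ((.cap, 1) :: (.cap, 1) :: (a ++ (Word.shift 2 b ++ (.cup, 1) ::
          (Word.shift 2 c ++ [(.cup, 1)])))) := by simpa using refl _
    Iso 2 2 _ ((.cap, 1) :: (.cap, 1) :: (a ++ (Word.shift 2 b ++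
          (Word.shift 4 c ++ [(.cup, 1), (.cup, 1)])))) := by
      simpa using (event_box (n := 2) (m := 2)
          ((.cap, 1) :: (.cap, 1) :: (a ++ Word.shift 2 b)) [(.cup, 1)] hc 4 2
        .cup 1 (by simp) (by simp) (by simp [ha, hb])).symm
    Iso 2 2 _ ((.cap, 1) :: (.cap, 3) :: (a ++ (Word.shift 2 b ++
          (Word.shift 4 c ++ [(.cup, 1), (.cup, 1)])))) := by
      simpa using (move (n := 2) (m := 2)
          [] (a ++ (Word.shift 2 b ++ (Word.shift 4 c ++ [(.cup, 1), (.cup, 1)])))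
        (.exchange .cap .cap 1 0) (by simp [ha, hb, hc])).symm
    Iso 2 2 _ ((.cap, 1) :: (a ++ ((.cap, 3) :: (Word.shift 2 b ++
          (Word.shift 4 c ++ [(.cup, 1), (.cup, 1)]))))) := by
      simpa using (box_event (n := 2) (m := 2) [(.cap, 1)] (Word.shift 2 b ++ (Word.shift 4 c ++
        [(.cup, 1), (.cup, 1)])) ha 0 .cap 3 (by simp) (by simp [hb, hc])).symm
    Iso 2 2 _ ((.cap, 1) :: (a ++ ((.cap, 3) :: (Word.shift 2 b ++
          (Word.shift 4 c ++ [(.cup, 3), (.cup, 1)]))))) := by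
      simpa using move (n := 2) (m := 2)
          ((.cap, 1) :: (a ++ ((.cap, 3) :: (Word.shift 2 b ++ Word.shift 4 c)))) []
        (.exchange .cup .cup 1 0) (by simp [ha, hb, hc])
    Iso 2 2 _ _ := by simpa using refl _

theorem Iso.zero_hSum (ha : IsTangle a 2 2) :
    Iso 2 2 (Knot.hSum twoHorizontalLines a) a := by
  unfold Knot.hSum twoHorizontalLines
  calc Iso 2 2 _ ((.cap, 0) :: (Word.shift 2 a ++ [(.cup, 1)])) := by
        simpa using move (n := 2) (m := 2)
            [] ((.cap, 0) :: (Word.shift 2 a ++ [(.cup, 1)])) (.zagzig 0)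
          (by simp [ha])
    Iso 2 2 _ (a ++ [(.cap, 0), (.cup, 1)]) := by
        simpa using (event_box (n := 2) (m := 2)
            [] [(.cup, 1)] ha 0 2 .cap 0 (by simp) (by simp) (by simp)).symm
    Iso 2 2 _ _ := by simpa using move a [] (.zigzag 0) (by simp [ha])

theorem Iso.hSum_zero (ha : IsTangle a 2 2) :
    Iso 2 2 (Knot.hSum a twoHorizontalLines) a := by
  unfold Knot.hSum twoHorizontalLines
  calc Iso 2 2 _ ((.cap, 1) :: (.cup, 2) :: (a ++ [(.cap, 2), (.cup, 1)])) := by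
        simpa using box_event (n := 2) (m := 2)
            [(.cap, 1)] [(.cap, 2), (.cup, 1)] ha 0 .cup 2 (by simp) (by simp)
    Iso 2 2 _ (a ++ [(.cap, 2), (.cup, 1)]) := by
        simpa using move (n := 2) (m := 2)
            [] (a ++ [(.cap, 2), (.cup, 1)]) (.zigzag 1) (by simp [ha])
    Iso 2 2 _ _ := by simpa using move a [] (.zagzig 1) (by simp [ha])

theorem Iso.rotate_hSum (ha : IsTangle a 2 2) (hb : IsTangle b 2 2) :
    Iso 2 2 (Knot.rotate (Knot.hSum a b)) (Knot.rotate a ++ Knot.rotate b) := by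
  unfold Knot.hSum Knot.rotate
  calc Iso 2 2 _ ((.cap, 2) :: (.cap, 2) :: (Word.shift 1 a ++ (Word.shift 3 b ++
          [(.cup, 2), (.cup, 0)]))) := by simpa using refl _
    Iso 2 2 _ ((.cap, 2) :: (.cap, 4) :: (Word.shift 1 a ++ (Word.shift 3 b ++
          [(.cup, 2), (.cup, 0)]))) := by
      simpa using (move (n := 2) (m := 2)
          [] (Word.shift 1 a ++ (Word.shift 3 b ++ [(.cup, 2), (.cup, 0)]))
        (.exchange .cap .cap 2 0) (by simp [ha, hb])).symm
    Iso 2 2 _ ((.cap, 2) :: (.cap, 4) :: (Word.shift 1 a ++ (Word.shift 3 b ++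
          [(.cup, 0), (.cup, 0)]))) := by
      simpa using (move (n := 2) (m := 2)
          ((.cap, 2) :: (.cap, 4) :: (Word.shift 1 a ++ Word.shift 3 b)) []
        (.exchange .cup .cup 0 0) (by simp [ha, hb])).symm
    Iso 2 2 _ ((.cap, 2) :: (Word.shift 1 a ++ ((.cap, 4) :: (Word.shift 3 b ++
          [(.cup, 0), (.cup, 0)])))) := by
      simpa using (box_event (n := 2) (m := 2)
          [(.cap, 2)] (Word.shift 3 b ++ [(.cup, 0), (.cup, 0)]) ha 1 .cap 4
        (by simp) (by simp [hb])).symm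
    Iso 2 2 _ ((.cap, 2) :: (Word.shift 1 a ++ ((.cap, 4) :: (.cup, 0) :: (Word.shift 1 b ++
          [(.cup, 0)])))) := by
      have h := event_box (n := 2) (m := 2)
          ((.cap, 2) :: (Word.shift 1 a ++ [(.cap, 4)])) [(.cup, 0)] hb 3 1
        .cup 0 (by simp) (by simp) (by simp [ha])
      simpa using h
    Iso 2 2 _ ((.cap, 2) :: (Word.shift 1 a ++ ((.cup, 0) :: (.cap, 2) :: (Word.shift 1 b ++
          [(.cup, 0)])))) := by
      simpa using (move (n := 2) (m := 2)
          ((.cap, 2) :: Word.shift 1 a) (Word.shift 1 b ++ [(.cup, 0)])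
        (.exchange .cup .cap 0 2) (by simp [ha, hb])).symm
    Iso 2 2 _ _ := by simpa using refl _

/-- The clockwise rotation brings the upper of two tangles to the right. -/
theorem Iso.rotate_append (ha : IsTangle a 2 2) (hb : IsTangle b 2 2) :
    Iso 2 2 (Knot.rotate (a ++ b)) (Knot.hSum (Knot.rotate b) (Knot.rotate a)) := by
  unfold Knot.hSum Knot.rotate
  symm
  calc Iso 2 2 _ ((.cap, 1) :: (.cap, 2) :: (Word.shift 1 b ++ ((.cup, 0) :: (.cap, 4) ::
          (Word.shift 3 a ++ [(.cup, 2), (.cup, 1)])))) := by simpa using refl _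
    Iso 2 2 _ ((.cap, 1) :: (.cap, 2) :: (Word.shift 1 b ++ ((.cap, 6) :: (.cup, 0) ::
          (Word.shift 3 a ++ [(.cup, 2), (.cup, 1)])))) := by
      simpa using move (n := 2) (m := 2) ((.cap, 1) :: (.cap, 2) :: Word.shift 1 b)
        (Word.shift 3 a ++ [(.cup, 2), (.cup, 1)]) (.exchange .cup .cap 0 4) (by simp [ha, hb])
    Iso 2 2 _ ((.cap, 1) :: (.cap, 2) :: (.cap, 6) :: (Word.shift 1 b ++ ((.cup, 0) ::
          (Word.shift 3 a ++ [(.cup, 2), (.cup, 1)])))) := by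
      simpa using box_event (n := 2) (m := 2) [(.cap, 1), (.cap, 2)]
        ((.cup, 0) :: (Word.shift 3 a ++ [(.cup, 2), (.cup, 1)])) hb 1 .cap 6
        (by simp) (by simp [ha])
    Iso 2 2 _ ((.cap, 1) :: (.cap, 2) :: (.cap, 6) :: (Word.shift 1 b ++ (Word.shift 5 a ++
          [(.cup, 0), (.cup, 2), (.cup, 1)]))) := by
      simpa using (event_box (n := 2) (m := 2)
          ((.cap, 1) :: (.cap, 2) :: (.cap, 6) :: Word.shift 1 b)
        [(.cup, 2), (.cup, 1)] ha 5 3 .cup 0 (by simp) (by simp) (by simp [hb])).symm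
    Iso 2 2 _ ((.cap, 1) :: (.cap, 2) :: (.cap, 6) :: (Word.shift 5 a ++ (Word.shift 1 b ++
          [(.cup, 0), (.cup, 2), (.cup, 1)]))) := by
      simpa using box_box (n := 2) (m := 2)
          [(.cap, 1), (.cap, 2), (.cap, 6)] [(.cup, 0), (.cup, 2), (.cup, 1)]
        hb ha 1 5 (by simp) (by simp)
    Iso 2 2 _ ((.cap, 1) :: (.cap, 4) :: (.cap, 2) :: (Word.shift 5 a ++ (Word.shift 1 b ++
          [(.cup, 0), (.cup, 2), (.cup, 1)]))) := by
      simpa using move (n := 2) (m := 2) [(.cap, 1)] (Word.shift 5 a ++ (Word.shift 1 b ++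
        [(.cup, 0), (.cup, 2), (.cup, 1)])) (.exchange .cap .cap 2 2) (by simp [ha, hb])
    Iso 2 2 _ ((.cap, 2) :: (.cap, 1) :: (.cap, 2) :: (Word.shift 5 a ++ (Word.shift 1 b ++
          [(.cup, 0), (.cup, 2), (.cup, 1)]))) := by
      simpa using move (n := 2) (m := 2) [] ((.cap, 2) :: (Word.shift 5 a ++ (Word.shift 1 b ++
        [(.cup, 0), (.cup, 2), (.cup, 1)]))) (.exchange .cap .cap 1 1) (by simp [ha, hb])
    Iso 2 2 _ ((.cap, 2) :: (.cap, 1) :: (Word.shift 3 a ++ ((.cap, 2) :: (Word.shift 1 b ++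
          [(.cup, 0), (.cup, 2), (.cup, 1)])))) := by
      simpa using (event_box (n := 2) (m := 2) [(.cap, 2), (.cap, 1)] (Word.shift 1 b ++
        [(.cup, 0), (.cup, 2), (.cup, 1)]) ha 3 5 .cap 2 (by simp) (by simp) (by simp [hb])).symm
    Iso 2 2 _ ((.cap, 2) :: (Word.shift 1 a ++ ((.cap, 1) :: (.cap, 2) :: (Word.shift 1 b ++
          [(.cup, 0), (.cup, 2), (.cup, 1)])))) := by
      simpa using (event_box (n := 2) (m := 2) [(.cap, 2)] ((.cap, 2) :: (Word.shift 1 b ++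
        [(.cup, 0), (.cup, 2), (.cup, 1)])) ha 1 3 .cap 1 (by simp) (by simp) (by simp [hb])).symm
    Iso 2 2 _ ((.cap, 2) :: (Word.shift 1 a ++ ((.cap, 1) :: (.cap, 2) :: (Word.shift 1 b ++
          [(.cup, 4), (.cup, 0), (.cup, 1)])))) := by
      simpa using move (n := 2) (m := 2)
          ((.cap, 2) :: (Word.shift 1 a ++ ((.cap, 1) :: (.cap, 2) :: Word.shift 1 b)))
        [(.cup, 1)] (.exchange .cup .cup 0 2) (by simp [ha, hb])
    Iso 2 2 _ ((.cap, 2) :: (Word.shift 1 a ++ ((.cap, 1) :: (.cap, 2) :: (.cup, 4) ::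
          (Word.shift 1 b ++ [(.cup, 0), (.cup, 1)])))) := by
      have h := box_event (n := 2) (m := 2)
          ((.cap, 2) :: (Word.shift 1 a ++ [(.cap, 1), (.cap, 2)]))
        [(.cup, 0), (.cup, 1)] hb 1 .cup 4 (by simp) (by simp [ha])
      simpa using h
    Iso 2 2 _ ((.cap, 2) :: (Word.shift 1 a ++ ((.cap, 1) :: (.cup, 2) :: (.cap, 2) ::
          (Word.shift 1 b ++ [(.cup, 0), (.cup, 1)])))) := by
      have h := move (n := 2) (m := 2) ((.cap, 2) :: (Word.shift 1 a ++ [(.cap, 1)]))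
        (Word.shift 1 b ++ [(.cup, 0), (.cup, 1)]) (.exchange .cap .cup 2 0) (by simp [ha, hb])
      simpa using h
    Iso 2 2 _ ((.cap, 2) :: (Word.shift 1 a ++ ((.cap, 2) ::
          (Word.shift 1 b ++ [(.cup, 0), (.cup, 1)])))) := by
      simpa using move (n := 2) (m := 2) ((.cap, 2) :: Word.shift 1 a)
        ((.cap, 2) :: (Word.shift 1 b ++ [(.cup, 0), (.cup, 1)])) (.zigzag 1) (by simp [ha, hb])
    Iso 2 2 _ ((.cap, 2) :: (Word.shift 1 a ++ ((.cap, 2) ::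
          (Word.shift 1 b ++ [(.cup, 3), (.cup, 0)])))) := by
      simpa using move (n := 2) (m := 2)
          ((.cap, 2) :: (Word.shift 1 a ++ ((.cap, 2) :: Word.shift 1 b))) []
        (.exchange .cup .cup 0 1) (by simp [ha, hb])
    Iso 2 2 _ ((.cap, 2) :: (Word.shift 1 a ++ ((.cap, 2) :: (.cup, 3) ::
          (Word.shift 1 b ++ [(.cup, 0)])))) := by
      have h := box_event (n := 2) (m := 2)
          ((.cap, 2) :: (Word.shift 1 a ++ [(.cap, 2)])) [(.cup, 0)] hb 1 .cup 3
        (by simp) (by simp [ha])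
      simpa using h
    Iso 2 2 _ ((.cap, 2) :: (Word.shift 1 a ++ (Word.shift 1 b ++ [(.cup, 0)]))) := by
      simpa using move (n := 2) (m := 2)
          ((.cap, 2) :: Word.shift 1 a) (Word.shift 1 b ++ [(.cup, 0)]) (.zigzag 2)
        (by simp [ha, hb])
    Iso 2 2 _ _ := by simpa using refl _

/-! ### Crossings -/

theorem Iso.rotate_pos : Iso 2 2 (Knot.rotate [(.pos, 0)]) [(.neg, 0)] := by
  calc Iso 2 2 [(.cap, 2), (.pos, 1), (.cup, 0)] [(.cap, 2), (.neg, 0), (.cup, 1)] :=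
        move (n := 2) (m := 2) [(.cap, 2)] [] (.cupSlideUnder 0) (by simp)
    Iso 2 2 _ [(.neg, 0), (.cap, 2), (.cup, 1)] :=
        (move (n := 2) (m := 2) [] [(.cup, 1)] (.exchange .neg .cap 0 0) (by simp)).symm
    Iso 2 2 _ _ := move (n := 2) (m := 2) [(.neg, 0)] [] (.zagzig 1) (by simp)

theorem Iso.rotate_neg : Iso 2 2 (Knot.rotate [(.neg, 0)]) [(.pos, 0)] := by
  calc Iso 2 2 [(.cap, 2), (.neg, 1), (.cup, 0)] [(.cap, 2), (.pos, 0), (.cup, 1)] :=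
        move (n := 2) (m := 2) [(.cap, 2)] [] (.cupSlideOver 0) (by simp)
    Iso 2 2 _ [(.pos, 0), (.cap, 2), (.cup, 1)] :=
        (move (n := 2) (m := 2) [] [(.cup, 1)] (.exchange .pos .cap 0 0) (by simp)).symm
    Iso 2 2 _ _ := move (n := 2) (m := 2) [(.pos, 0)] [] (.zagzig 1) (by simp)

theorem Iso.rotate_zero : Iso 2 2 (Knot.rotate twoHorizontalLines) [] := by
  calc Iso 2 2 [(.cap, 2), (.cup, 1), (.cap, 1), (.cup, 0)] [(.cap, 1), (.cup, 0)] :=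
        move (n := 2) (m := 2) [] [(.cap, 1), (.cup, 0)] (.zagzig 1) (by simp)
    Iso 2 2 _ _ := move (n := 2) (m := 2) [] [] (.zagzig 0) (by simp)

theorem Iso.rotate_nil : Iso 2 2 (Knot.rotate []) twoHorizontalLines :=
  (move (n := 2) (m := 2) [] [] (.exchange .cup .cap 0 0) (by simp)).symm

theorem Iso.pos_hSum_neg : Iso 2 2 (Knot.hSum [(.pos, 0)] [(.neg, 0)]) twoHorizontalLines := by
  calc Iso 2 2 [(.cap, 1), (.pos, 0), (.neg, 2), (.cup, 1)]
        [(.cap, 1), (.pos, 0), (.pos, 1), (.cup, 2)] :=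
        move (n := 2) (m := 2) [(.cap, 1), (.pos, 0)] [] (.cupSlideOver 1) (by simp)
    Iso 2 2 _ [(.cap, 0), (.neg, 1), (.pos, 1), (.cup, 2)] :=
        (move (n := 2) (m := 2) [] [(.pos, 1), (.cup, 2)] (.capSlideUnder 0) (by simp)).symm
    Iso 2 2 _ [(.cap, 0), (.cup, 2)] := move (n := 2) (m := 2)
        [(.cap, 0)] [(.cup, 2)] (.negPos 1) (by simp)
    Iso 2 2 _ _ := move (n := 2) (m := 2) [] [] (.exchange .cap .cup 0 0) (by simp)

theorem Iso.neg_hSum_pos : Iso 2 2 (Knot.hSum [(.neg, 0)] [(.pos, 0)]) twoHorizontalLines := by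
  calc Iso 2 2 [(.cap, 1), (.neg, 0), (.pos, 2), (.cup, 1)]
        [(.cap, 1), (.neg, 0), (.neg, 1), (.cup, 2)] :=
        move (n := 2) (m := 2) [(.cap, 1), (.neg, 0)] [] (.cupSlideUnder 1) (by simp)
    Iso 2 2 _ [(.cap, 0), (.pos, 1), (.neg, 1), (.cup, 2)] :=
        (move (n := 2) (m := 2) [] [(.neg, 1), (.cup, 2)] (.capSlideOver 0) (by simp)).symm
    Iso 2 2 _ [(.cap, 0), (.cup, 2)] := move (n := 2) (m := 2)
        [(.cap, 0)] [(.cup, 2)] (.posNeg 1) (by simp)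
    Iso 2 2 _ _ := move (n := 2) (m := 2) [] [] (.exchange .cap .cup 0 0) (by simp)

theorem Iso.pos_hSum_nil : Iso 2 2 (Knot.hSum [(.pos, 0)] []) [] := by
  calc Iso 2 2 [(.cap, 1), (.pos, 0), (.cup, 1)] [(.cap, 0), (.neg, 1), (.cup, 1)] :=
        (move (n := 2) (m := 2) [] [(.cup, 1)] (.capSlideUnder 0) (by simp)).symm
    Iso 2 2 _ [(.cap, 0), (.cup, 1)] := move (n := 2) (m := 2)
        [(.cap, 0)] [] (.cupCurlNeg 1) (by simp)
    Iso 2 2 _ _ := move (n := 2) (m := 2) [] [] (.zigzag 0) (by simp)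

/-- The strand that starts at the top left passes under the crossing and ends at the lower right end
point of `a`, after a second underpass on the right of `a`. Sliding it below `a` to the left gives
the diagram on the right-hand side. For rational tangles this is the identity
`1 / (1 + 1 / (x - 1)) = 1 - 1 / x` of fractions. -/
theorem Iso.pos_append_hSum_neg (ha : IsTangle a 2 2) :
    Iso 2 2 ((.pos, 0) :: Knot.hSum a [(.neg, 0)]) (Knot.hSum [(.pos, 0)] (Knot.rotate a)) := by
  have hslide : Iso 4 4 ((.pos, 0) :: (.pos, 1) :: a)
      (Word.shift 1 a ++ [(.pos, 0), (.pos, 1)]) := by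
    simpa [underpass] using (underpass_word ha).shift 0 1
  unfold Knot.hSum Knot.rotate
  trans ((.cap, 2) :: (Word.shift 1 a ++ [(.pos, 0), (.cup, 1)]))
  · calc Iso 2 2 _ ((.pos, 0) :: (.cap, 1) :: (.neg, 2) :: (.pos, 2) :: (a ++ [(.neg, 2),
            (.cup, 1)])) := by
          simpa using (move (n := 2) (m := 2)
              [(.pos, 0), (.cap, 1)] (a ++ [(.neg, 2), (.cup, 1)]) (.negPos 2)
            (by simp [ha])).symm
      Iso 2 2 _ ((.pos, 0) :: (.cap, 2) :: (.pos, 1) :: (.pos, 2) :: (a ++ [(.neg, 2),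
            (.cup, 1)])) := by
          simpa using (move (n := 2) (m := 2)
              [(.pos, 0)] ((.pos, 2) :: (a ++ [(.neg, 2), (.cup, 1)]))
            (.capSlideUnder 1) (by simp [ha]))
      Iso 2 2 _ ((.pos, 0) :: (.cap, 2) :: (.pos, 1) :: (a ++ [(.pos, 2), (.neg, 2),
            (.cup, 1)])) := by
          simpa using (box_event (n := 2) (m := 2)
              [(.pos, 0), (.cap, 2), (.pos, 1)] [(.neg, 2), (.cup, 1)] ha 0
            .pos 2 (by simp) (by simp)).symm
      Iso 2 2 _ ((.pos, 0) :: (.cap, 2) :: (.pos, 1) :: (a ++ [(.cup, 1)])) := by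
          simpa using move (n := 2) (m := 2)
              ((.pos, 0) :: (.cap, 2) :: (.pos, 1) :: a) [(.cup, 1)] (.posNeg 2)
            (by simp [ha])
      Iso 2 2 _ ((.cap, 2) :: (.pos, 0) :: (.pos, 1) :: (a ++ [(.cup, 1)])) := by
          simpa using move (n := 2) (m := 2)
              [] ((.pos, 1) :: (a ++ [(.cup, 1)])) (.exchange .pos .cap 0 0)
            (by simp [ha])
      Iso 2 2 _ ((.cap, 2) :: (Word.shift 1 a ++ [(.pos, 0), (.pos, 1), (.cup, 1)])) := by
          simpa using hslide.ctx (n := 2) (m := 2) [(.cap, 2)] [(.cup, 1)] (by simp) (by simp)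
      Iso 2 2 _ _ := by
          have h := move (n := 2) (m := 2)
              ((.cap, 2) :: (Word.shift 1 a ++ [(.pos, 0)])) [] (.cupCurlPos 1)
            (by simp [ha])
          simpa using h
  · symm
    calc Iso 2 2 _ ((.cap, 1) :: (.pos, 0) :: (.cap, 4) :: (Word.shift 3 a ++ [(.cup, 2),
            (.cup, 1)])) := by simpa using refl _
      Iso 2 2 _ ((.cap, 1) :: (.cap, 4) :: (.pos, 0) :: (Word.shift 3 a ++ [(.cup, 2),
            (.cup, 1)])) := by
          simpa using move (n := 2) (m := 2) [(.cap, 1)] (Word.shift 3 a ++ [(.cup, 2), (.cup, 1)])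
            (.exchange .pos .cap 0 2) (by simp [ha])
      Iso 2 2 _ ((.cap, 2) :: (.cap, 1) :: (.pos, 0) :: (Word.shift 3 a ++ [(.cup, 2),
            (.cup, 1)])) := by
          simpa using move (n := 2) (m := 2)
              [] ((.pos, 0) :: (Word.shift 3 a ++ [(.cup, 2), (.cup, 1)]))
            (.exchange .cap .cap 1 1) (by simp [ha])
      Iso 2 2 _ ((.cap, 2) :: (.cap, 1) :: (Word.shift 3 a ++ [(.pos, 0), (.cup, 2),
            (.cup, 1)])) := by
          simpa using (event_box (n := 2) (m := 2)
              [(.cap, 2), (.cap, 1)] [(.cup, 2), (.cup, 1)] ha 3 3 .pos 0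
            (by simp) (by simp) (by simp)).symm
      Iso 2 2 _ ((.cap, 2) :: (Word.shift 1 a ++ [(.cap, 1), (.pos, 0), (.cup, 2),
            (.cup, 1)])) := by
          simpa using (event_box (n := 2) (m := 2)
              [(.cap, 2)] [(.pos, 0), (.cup, 2), (.cup, 1)] ha 1 3 .cap 1
            (by simp) (by simp) (by simp)).symm
      Iso 2 2 _ ((.cap, 2) :: (Word.shift 1 a ++ [(.cap, 1), (.cup, 2), (.pos, 0),
            (.cup, 1)])) := by
          have h := move (n := 2) (m := 2)
              ((.cap, 2) :: (Word.shift 1 a ++ [(.cap, 1)])) [(.cup, 1)]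
            (.exchange .pos .cup 0 0) (by simp [ha])
          simpa using h
      Iso 2 2 _ _ := by
          simpa using move (n := 2) (m := 2)
              ((.cap, 2) :: Word.shift 1 a) [(.pos, 0), (.cup, 1)] (.zigzag 1)
            (by simp [ha])

end

/-! ### Tangles of binary trees -/

/-- The tangle that a binary tree contributes to the link of a positive element of the Thompson
group: a caret adds a positive crossing and the rotated tangle of its left subtree to the left of
the tangle of its right subtree. -/
def treeTangle : BinTree → Word
  | .nil => twoHorizontalLines
  | .node _ l r => hSum (hSum [(.pos, 0)] (rotate (treeTangle l))) (treeTangle r)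

theorem isTangle_pos : IsTangle [(.pos, 0)] 2 2 := by simp

theorem isTangle_neg : IsTangle [(.neg, 0)] 2 2 := by simp

theorem isTangle_nil_two : IsTangle [] 2 2 := .nil 2

theorem isTangle_treeTangle (T : BinTree) : IsTangle (treeTangle T) 2 2 := by
  induction T with
  | nil => exact isTangle_twoHorizontalLines
  | node _ l r ihl ihr => exact (isTangle_pos.hSum ihl.rotate).hSum ihr

/-- The tangle `a` is isotopic to the tangle of a binary tree. -/
def Realizable (a : Word) : Prop := ∃ T : BinTree, Iso 2 2 (treeTangle T) a

namespace Realizable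

variable {a b : Word}

theorem isTangle (h : Realizable a) : IsTangle a 2 2 := by
  obtain ⟨T, hT⟩ := h
  exact hT.isTangle_iff.1 (isTangle_treeTangle T)

theorem congr (h : Realizable a) (hab : Iso 2 2 a b) : Realizable b := by
  obtain ⟨T, hT⟩ := h
  exact ⟨T, hT.trans hab⟩

theorem zero : Realizable twoHorizontalLines := ⟨.nil, .refl _⟩

theorem node (ha : Realizable a) (hb : Realizable b) :
    Realizable (hSum (hSum [(.pos, 0)] (rotate a)) b) := by
  obtain ⟨A, hA⟩ := ha
  obtain ⟨B, hB⟩ := hb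
  have ta := hA.isTangle_iff.1 (isTangle_treeTangle A)
  have tb := hB.isTangle_iff.1 (isTangle_treeTangle B)
  exact ⟨.node () A B, (Iso.hSum (.refl _) hA.rotate isTangle_pos ta.rotate).hSum hB
    (isTangle_pos.hSum (isTangle_treeTangle A).rotate) tb⟩

theorem nil : Realizable [] :=
  (node zero zero).congr <|
    (Iso.hSum_zero (isTangle_pos.hSum isTangle_twoHorizontalLines.rotate)).trans <|
      (Iso.hSum (.refl _) .rotate_zero isTangle_pos isTangle_nil_two).trans .pos_hSum_nil

theorem pos_hSum (hb : Realizable b) : Realizable (hSum [(.pos, 0)] b) := by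
  refine (node nil hb).congr (Iso.hSum ?_ (.refl _) (isTangle_pos.hSum isTangle_nil_two.rotate)
    hb.isTangle)
  exact (Iso.hSum (.refl _) .rotate_nil isTangle_pos isTangle_twoHorizontalLines).trans
    (.hSum_zero isTangle_pos)

/-- The tangle of a caret with an empty right branch, in its other form. -/
theorem pos_append_hSum_neg (ha : Realizable a) :
    Realizable ((.pos, 0) :: hSum a [(.neg, 0)]) :=
  (node ha zero).congr <| (Iso.hSum_zero (isTangle_pos.hSum ha.isTangle.rotate)).trans
    (Iso.pos_append_hSum_neg ha.isTangle).symm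

theorem pos_pos : Realizable [(.pos, 0), (.pos, 0)] := by
  refine (pos_append_hSum_neg (pos_hSum (pos_hSum zero))).congr ?_
  have h0 := isTangle_twoHorizontalLines
  refine Iso.append_left [(.pos, 0)] (k := 2) ?_ isTangle_pos
  -- `(1 + (1 + 0)) + (-1) = 1`
  calc Iso 2 2 _ (hSum (hSum [(.pos, 0)] [(.pos, 0)]) [(.neg, 0)]) :=
        Iso.hSum (Iso.hSum (.refl _) (.hSum_zero isTangle_pos) isTangle_pos isTangle_pos)
          (.refl _) (isTangle_pos.hSum (isTangle_pos.hSum h0)) isTangle_neg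
    Iso 2 2 _ (hSum [(.pos, 0)] (hSum [(.pos, 0)] [(.neg, 0)])) :=
        .hSum_assoc isTangle_pos isTangle_pos isTangle_neg
    Iso 2 2 _ (hSum [(.pos, 0)] twoHorizontalLines) :=
        .hSum (.refl _) .pos_hSum_neg isTangle_pos h0
    Iso 2 2 _ _ := .hSum_zero isTangle_pos

/-- Two positive crossings below each other become two negative ones side by side after a quarter
turn, and one of these cancels with the positive crossing of the caret. -/
theorem neg_hSum (hb : Realizable b) : Realizable (hSum [(.neg, 0)] b) := by
  refine (node pos_pos hb).congr (Iso.hSum ?_ (.refl _)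
    (isTangle_pos.hSum pos_pos.isTangle.rotate) hb.isTangle)
  calc Iso 2 2 _ (hSum [(.pos, 0)] (hSum (rotate [(.pos, 0)]) (rotate [(.pos, 0)]))) :=
        .hSum (.refl _) (.rotate_append isTangle_pos isTangle_pos) isTangle_pos
          (isTangle_pos.rotate.hSum isTangle_pos.rotate)
    Iso 2 2 _ (hSum [(.pos, 0)] (hSum [(.neg, 0)] [(.neg, 0)])) :=
        .hSum (.refl _) (.hSum .rotate_pos .rotate_pos isTangle_pos.rotate isTangle_neg)
          isTangle_pos (isTangle_neg.hSum isTangle_neg)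
    Iso 2 2 _ (hSum (hSum [(.pos, 0)] [(.neg, 0)]) [(.neg, 0)]) :=
        (Iso.hSum_assoc isTangle_pos isTangle_neg isTangle_neg).symm
    Iso 2 2 _ (hSum twoHorizontalLines [(.neg, 0)]) :=
        .hSum .pos_hSum_neg (.refl _) (isTangle_pos.hSum isTangle_neg) isTangle_neg
    Iso 2 2 _ _ := .zero_hSum isTangle_neg

/-- A negative crossing removes the positive one that a caret adds. -/
theorem rotate_hSum (ha : Realizable a) (hb : Realizable b) : Realizable (hSum (rotate a) b) := by
  have ta := ha.isTangle.rotate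
  have tb := hb.isTangle
  refine (neg_hSum (node ha hb)).congr ?_
  calc Iso 2 2 _ (hSum [(.neg, 0)] (hSum [(.pos, 0)] (hSum (rotate a) b))) :=
        .hSum (.refl _) (.hSum_assoc isTangle_pos ta tb) isTangle_neg
          (isTangle_pos.hSum (ta.hSum tb))
    Iso 2 2 _ (hSum (hSum [(.neg, 0)] [(.pos, 0)]) (hSum (rotate a) b)) :=
        (Iso.hSum_assoc isTangle_neg isTangle_pos (ta.hSum tb)).symm
    Iso 2 2 _ (hSum twoHorizontalLines (hSum (rotate a) b)) :=
        .hSum .neg_hSum_pos (.refl _) (isTangle_neg.hSum isTangle_pos) (ta.hSum tb)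
    Iso 2 2 _ _ := .zero_hSum (ta.hSum tb)

/-- The tree of a realizable tangle may be assumed to have a caret. -/
theorem exists_ne_nil (ha : Realizable a) :
    ∃ T : BinTree, T ≠ .nil ∧ Iso 2 2 (treeTangle T) a := by
  obtain ⟨N, hN⟩ := neg_hSum ha
  have ta := ha.isTangle
  have tn := isTangle_neg.hSum ta
  obtain ⟨C, hC⟩ := nil
  refine ⟨.node () C N, by simp, ?_⟩
  calc Iso 2 2 (hSum (hSum [(.pos, 0)] (Knot.rotate (treeTangle C))) (treeTangle N))
        (hSum (hSum [(.pos, 0)] (Knot.rotate [])) (hSum [(.neg, 0)] a)) :=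
        .hSum (.hSum (.refl _) hC.rotate isTangle_pos isTangle_nil_two.rotate) hN
          (isTangle_pos.hSum (isTangle_treeTangle C).rotate) tn
    Iso 2 2 _ (hSum (hSum [(.pos, 0)] twoHorizontalLines) (hSum [(.neg, 0)] a)) :=
        .hSum (.hSum (.refl _) .rotate_nil isTangle_pos isTangle_twoHorizontalLines) (.refl _)
          (isTangle_pos.hSum isTangle_nil_two.rotate) tn
    Iso 2 2 _ (hSum [(.pos, 0)] (hSum [(.neg, 0)] a)) :=
        .hSum (.hSum_zero isTangle_pos) (.refl _)
          (isTangle_pos.hSum isTangle_twoHorizontalLines) tn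
    Iso 2 2 _ (hSum (hSum [(.pos, 0)] [(.neg, 0)]) a) :=
        (Iso.hSum_assoc isTangle_pos isTangle_neg ta).symm
    Iso 2 2 _ (hSum twoHorizontalLines a) :=
        .hSum .pos_hSum_neg (.refl _) (isTangle_pos.hSum isTangle_neg) ta
    Iso 2 2 _ _ := .zero_hSum ta

end Realizable

/-! ### Algebraic tangles -/

/-- Formal expressions for algebraic tangles: two horizontal or two vertical lines, the two
crossings, and the composites of two tangles side by side and below each other. -/
inductive AlgTangle
  | horizontal
  | vertical
  | pos
  | neg
  | beside (x y : AlgTangle)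
  | above (x y : AlgTangle)

namespace AlgTangle

/-- The tangle diagram of an expression. -/
def word : AlgTangle → Word
  | horizontal => twoHorizontalLines
  | vertical => []
  | pos => [(.pos, 0)]
  | neg => [(.neg, 0)]
  | beside x y => hSum x.word y.word
  | above x y => x.word ++ y.word

/-- The clockwise rotation by a quarter turn of an expression. -/
def turn : AlgTangle → AlgTangle
  | horizontal => vertical
  | vertical => horizontal
  | pos => neg
  | neg => pos
  | beside x y => above x.turn y.turn
  | above x y => beside y.turn x.turn

theorem isTangle_word (x : AlgTangle) : IsTangle x.word 2 2 := by
  induction x with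
  | horizontal => exact isTangle_twoHorizontalLines
  | vertical => exact isTangle_nil_two
  | pos => exact isTangle_pos
  | neg => exact isTangle_neg
  | beside x y ihx ihy => exact ihx.hSum ihy
  | above x y ihx ihy => exact ihx.append ihy

theorem rotate_word (x : AlgTangle) : Iso 2 2 (rotate x.word) x.turn.word := by
  induction x with
  | horizontal => exact .rotate_zero
  | vertical => exact .rotate_nil
  | pos => exact .rotate_pos
  | neg => exact .rotate_neg
  | beside x y ihx ihy =>
    refine (Iso.rotate_hSum x.isTangle_word y.isTangle_word).trans ?_
    exact (ihx.append_right _ y.isTangle_word.rotate).trans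
      (ihy.append_left _ x.turn.isTangle_word)
  | above x y ihx ihy =>
    refine (Iso.rotate_append x.isTangle_word y.isTangle_word).trans ?_
    exact Iso.hSum ihy ihx y.isTangle_word.rotate x.turn.isTangle_word

theorem turn_four (x : AlgTangle) : x.turn.turn.turn.turn = x := by
  induction x <;> simp_all [turn]

/-- The tangle `x` can be added on the left of every realizable tangle. -/
def Addable (x : AlgTangle) : Prop := ∀ b, Realizable b → Realizable (hSum x.word b)

theorem Addable.realizable {x : AlgTangle} (h : x.Addable) : Realizable x.word :=
  (h _ .zero).congr (.hSum_zero x.isTangle_word)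

theorem Addable.beside {x y : AlgTangle} (hx : x.Addable) (hy : y.Addable) :
    (beside x y).Addable := fun b hb =>
  (hx _ (hy b hb)).congr (Iso.hSum_assoc x.isTangle_word y.isTangle_word hb.isTangle).symm

theorem Addable.turn {x : AlgTangle} (hx : x.Addable) : x.turn.Addable := fun _ hb =>
  (hx.realizable.rotate_hSum hb).congr
    (Iso.hSum x.rotate_word (.refl _) x.isTangle_word.rotate hb.isTangle)

theorem addable_horizontal : horizontal.Addable := fun _ hb =>
  hb.congr (Iso.zero_hSum hb.isTangle).symm

/-- Three quarter turns take two tangles below each other to two tangles side by side, and a fourth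
one leads back to the given tangle, since four quarter turns of an expression are trivial. The half
turn is part of the statement because the induction needs the third turn of the summands. -/
theorem addable_turns (x : AlgTangle) : x.Addable ∧ x.turn.turn.Addable := by
  induction x with
  | horizontal => exact ⟨addable_horizontal, addable_horizontal⟩
  | vertical => exact ⟨addable_horizontal.turn, addable_horizontal.turn⟩
  | pos => exact ⟨fun _ hb => hb.pos_hSum, fun _ hb => hb.pos_hSum⟩
  | neg => exact ⟨fun _ hb => hb.neg_hSum, fun _ hb => hb.neg_hSum⟩
  | beside x y ihx ihy => exact ⟨ihx.1.beside ihy.1, ihy.2.beside ihx.2⟩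
  | above x y ihx ihy =>
    have h : (above x y).turn.Addable := ihy.1.turn.beside ihx.1.turn
    refine ⟨?_, h.turn⟩
    have h3 : (above x y).turn.turn.turn.Addable := ihx.2.turn.beside ihy.2.turn
    simpa only [turn_four] using h3.turn

theorem realizable (x : AlgTangle) : Realizable x.word := x.addable_turns.1.realizable

end AlgTangle

/-! ### Arborescent tangles are algebraic -/

theorem exists_algTangle_crossing (w : ℤ) : ∃ x : AlgTangle, x.word = crossing w := by
  unfold crossing
  split_ifs
  exacts [⟨.pos, rfl⟩, ⟨.neg, rfl⟩]

theorem exists_algTangle_hTwist (w : ℤ) : ∃ x : AlgTangle, x.word = hTwist w := by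
  obtain ⟨c, hc⟩ := exists_algTangle_crossing w
  unfold hTwist
  induction w.natAbs with
  | zero => exact ⟨.horizontal, rfl⟩
  | succ k ih =>
    obtain ⟨x, hx⟩ := ih
    rw [Function.iterate_succ_apply']
    exact ⟨.beside c x, by rw [AlgTangle.word, hc, hx]⟩

theorem exists_algTangle_vTwist (w : ℤ) : ∃ x : AlgTangle, x.word = vTwist w := by
  obtain ⟨c, hc⟩ := exists_algTangle_crossing w
  unfold vTwist
  induction w.natAbs with
  | zero => exact ⟨.vertical, rfl⟩
  | succ k ih =>
    obtain ⟨x, hx⟩ := ih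
    rw [List.replicate_succ, List.flatten_cons]
    exact ⟨.above c x, by rw [AlgTangle.word, hc, hx]⟩

mutual

theorem exists_algTangle_hTangle : (t : WeightedTree) → ∃ x : AlgTangle, x.word = t.hTangle
  | .node w ts => by
    obtain ⟨x, hx⟩ := exists_algTangle_hTwist w
    obtain ⟨y, hy⟩ := exists_algTangle_hAttach ts
    exact ⟨.beside x y, by rw [AlgTangle.word, WeightedTree.hTangle, hx, hy]⟩

theorem exists_algTangle_hAttach : (ts : List WeightedTree) →
    ∃ x : AlgTangle, x.word = WeightedTree.hAttach ts
  | [] => ⟨.horizontal, by rw [AlgTangle.word, WeightedTree.hAttach]⟩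
  | t :: ts => by
    obtain ⟨x, hx⟩ := exists_algTangle_vTangle t
    obtain ⟨y, hy⟩ := exists_algTangle_hAttach ts
    exact ⟨.beside x y, by rw [AlgTangle.word, WeightedTree.hAttach, hx, hy]⟩

theorem exists_algTangle_vTangle : (t : WeightedTree) → ∃ x : AlgTangle, x.word = t.vTangle
  | .node w ts => by
    obtain ⟨x, hx⟩ := exists_algTangle_vTwist w
    obtain ⟨y, hy⟩ := exists_algTangle_vAttach ts
    exact ⟨.above x y, by rw [AlgTangle.word, WeightedTree.vTangle, hx, hy]⟩

theorem exists_algTangle_vAttach : (ts : List WeightedTree) →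
    ∃ x : AlgTangle, x.word = WeightedTree.vAttach ts
  | [] => ⟨.vertical, by rw [AlgTangle.word, WeightedTree.vAttach]⟩
  | t :: ts => by
    obtain ⟨x, hx⟩ := exists_algTangle_hTangle t
    obtain ⟨y, hy⟩ := exists_algTangle_vAttach ts
    exact ⟨.above x y, by rw [AlgTangle.word, WeightedTree.vAttach, hx, hy]⟩

end

/-! ### The link of a pair whose bottom tree is a right comb -/

theorem Word.flip_cons (e : Event) (i : ℕ) (w : Word) :
    Word.flip ((e, i) :: w) = Word.flip w ++ [(e.flip, i)] := by
  simp [Word.flip]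

theorem Word.flip_shift (k : ℕ) (w : Word) :
    Word.flip (Word.shift k w) = Word.shift k (Word.flip w) := by
  simp [Word.flip, Word.shift]

theorem numNodes_rightComb (n : ℕ) : (rightComb n).numNodes = n := by
  induction n with
  | zero => rfl
  | succ n ih => simp [rightComb, BinaryTree.numNodes, ih]

/-- The diagram above the root edge of the right comb with `n` carets in the lower half-plane. -/
def combWord (n : ℕ) : Word := Word.flip (branchWord (rightComb n))

theorem combWord_succ (n : ℕ) :
    combWord (n + 1) = Word.shift 2 (combWord n) ++ [(.pos, 1), (.cup, 0)] := by
  simp [combWord, rightComb, branchWord, Word.flip_cons, Word.flip_shift, BinaryTree.numNodes,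
    Event.flip]

theorem combWord_add (k r : ℕ) :
    combWord (k + r) = Word.shift (2 * k) (combWord r) ++ combWord k := by
  induction k with
  | zero => simp [combWord, rightComb, branchWord, Word.flip]
  | succ k ih =>
    rw [Nat.add_right_comm, combWord_succ, ih, combWord_succ]
    simp [Nat.mul_add, Nat.add_comm]

theorem isTangle_combWord (n : ℕ) : IsTangle (combWord n) (2 * n + 1) 1 := by
  simpa only [combWord, numNodes_rightComb] using (isTangle_branchWord (rightComb n)).flip

/-- The diagram of a tree `T` above the part of a right comb that meets it. The end points at the
top are the edge above `T`, the strand that reaches the ground to the right of `T`, and the edge at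
which the rest of the comb is attached; the end point at the bottom is the root edge of this part
of the comb. -/
def graft (T : BinTree) : Word := branchWord T ++ combWord (T.numNodes + 1)

theorem isTangle_graft (T : BinTree) : IsTangle (graft T) 3 1 := by
  have h1 := (isTangle_branchWord T).shift 0 2
  refine IsTangle.append (m := 2 * (T.numNodes + 1) + 1) ?_ (isTangle_combWord _)
  exact (Word.shift_zero (branchWord T) ▸ h1).of_eq (by omega) (by omega)

/-- A right comb is a shorter right comb with another one attached at its last leaf, hence the
graft of a tree splits into those of its two branches. -/
theorem graft_node (l r : BinTree) :
    Iso 3 1 (graft (.node () l r))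
      ((.cap, 0) :: (.neg, 1) :: (Word.shift 2 (graft r) ++ graft l)) := by
  have h1 : combWord ((BinaryTree.node () l r).numNodes + 1) =
      Word.shift (2 * l.numNodes + 2) (combWord (r.numNodes + 1)) ++ combWord (l.numNodes + 1) := by
    have e : (BinaryTree.node () l r).numNodes + 1 = (l.numNodes + 1) + (r.numNodes + 1) := by
      simp only [BinaryTree.numNodes]; omega
    rw [e, combWord_add]
    rfl
  have h2 := Iso.exchange ((isTangle_branchWord l).shift 0 1) (isTangle_graft r) 0
  have e3 : 0 + (2 * l.numNodes + 1) + 1 = 2 * l.numNodes + 2 := by omega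
  rw [e3] at h2
  have h4 := Iso.ctx (n := 3) (m := 1) [(.cap, 0), (.neg, 1)] (combWord (l.numNodes + 1)) h2
    (by simp) ((isTangle_combWord _).of_eq (by omega) rfl)
  rw [graft, h1]
  simpa [graft, branchWord] using h4

/-- The graft is the tangle of the tree with a negative crossing on its right, the lower right end
point being bent upwards. -/
theorem graft_iso (T : BinTree) :
    Iso 3 1 (graft T) (hSum (treeTangle T) [(.neg, 0)] ++ [(.cup, 1)]) := by
  induction T with
  | nil =>
    have h1 : Iso 3 1 [(.pos, 1), (.cup, 0)] [(.neg, 0), (.cup, 1)] :=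
      .of_move (.cupSlideUnder 0) (by simp)
    have h2 : Iso 3 1 (hSum twoHorizontalLines [(.neg, 0)] ++ [(.cup, 1)])
        [(.neg, 0), (.cup, 1)] := by
      refine Iso.append_right (m := 1) (y := [(.neg, 0)]) [(.cup, 1)] (k := 3) ?_ (by simp)
      simpa using (Iso.zero_hSum isTangle_neg).shift 0 1
    exact h1.trans h2.symm
  | node _ l r ihl ihr =>
    have tl := isTangle_treeTangle l
    have tr := isTangle_treeTangle r
    have hl := tl.hSum isTangle_neg
    have hr := tr.hSum isTangle_neg
    have hlr : Iso 2 2 (hSum ((.pos, 0) :: hSum (treeTangle l) [(.neg, 0)])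
        (hSum (treeTangle r) [(.neg, 0)])) (hSum (treeTangle (.node () l r)) [(.neg, 0)]) :=
      (Iso.hSum (Iso.pos_append_hSum_neg tl) (.refl _) (isTangle_pos.append hl) hr).trans
        (Iso.hSum_assoc (isTangle_pos.hSum tl.rotate) tr isTangle_neg).symm
    have hlr' : Iso 3 1 (hSum ((.pos, 0) :: hSum (treeTangle l) [(.neg, 0)])
        (hSum (treeTangle r) [(.neg, 0)]) ++ [(.cup, 1)])
        (hSum (treeTangle (.node () l r)) [(.neg, 0)] ++ [(.cup, 1)]) := by
      refine Iso.append_right (m := 1) [(.cup, 1)] (k := 3) ?_ (by simp)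
      simpa using hlr.shift 0 1
    refine (graft_node l r).trans (Iso.trans ?_ hlr')
    generalize hSum (treeTangle l) [(.neg, 0)] = x at *
    generalize hSum (treeTangle r) [(.neg, 0)] = y at *
    calc Iso 3 1 _ ((.cap, 0) :: (.neg, 1) :: (Word.shift 2 y ++ (.cup, 3) :: graft l)) := by
          simpa using (ihr.shift 2 0).ctx (n := 3) (m := 1) [(.cap, 0), (.neg, 1)] (graft l)
            (by simp) (isTangle_graft l)
      Iso 3 1 _ ((.cap, 0) :: (.neg, 1) ::
          (Word.shift 2 y ++ (.cup, 3) :: (x ++ [(.cup, 1)]))) := by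
          have h := Iso.append_left (n := 3) (m := 1)
            ((.cap, 0) :: (.neg, 1) :: (Word.shift 2 y ++ [(.cup, 3)])) ihl (by simp [hr])
          simpa using h
      Iso 3 1 _ ((.cap, 0) :: (.neg, 1) :: (Word.shift 2 y ++ (x ++ [(.cup, 3), (.cup, 1)]))) := by
          simpa using (Iso.box_event (n := 3) (m := 1)
            ((.cap, 0) :: (.neg, 1) :: Word.shift 2 y) [(.cup, 1)] hl 0 .cup 3 (by simp)
            (by simp [hr])).symm
      Iso 3 1 _ ((.cap, 0) :: (.neg, 1) :: (Word.shift 2 y ++ (x ++ [(.cup, 1), (.cup, 1)]))) := by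
          simpa using (Iso.move (n := 3) (m := 1)
            ((.cap, 0) :: (.neg, 1) :: (Word.shift 2 y ++ x)) []
            (.exchange .cup .cup 1 0) (by simp [hl, hr])).symm
      Iso 3 1 _ ((.cap, 0) :: (.neg, 1) :: (x ++ (Word.shift 2 y ++ [(.cup, 1), (.cup, 1)]))) := by
          simpa using (Iso.box_box (n := 3) (m := 1) [(.cap, 0), (.neg, 1)]
            [(.cup, 1), (.cup, 1)] hl hr 0 2 (by simp) (by simp)).symm
      Iso 3 1 _ ((.cap, 1) :: (.pos, 0) :: (x ++ (Word.shift 2 y ++ [(.cup, 1), (.cup, 1)]))) := by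
          simpa using (Iso.move (n := 3) (m := 1) []
            (x ++ (Word.shift 2 y ++ [(.cup, 1), (.cup, 1)])) (.capSlideUnder 0)
            (by simp [hl, hr]))
      Iso 3 1 _ _ := by simpa [hSum] using Iso.refl _

/-- The closure of a tangle with four end points that joins the two end points on the left and the
two end points on the right. -/
def sideClosure (a : Word) : Word :=
  (.cap, 0) :: (.cap, 2) :: (Word.shift 1 a ++ [(.cup, 2), (.cup, 0)])

/-- A crossing on the left is a curl of the side closure. -/
theorem sideClosure_pos_hSum {b : Word} (hb : IsTangle b 2 2) :
    Iso 0 0 (sideClosure (hSum [(.pos, 0)] b)) (sideClosure b) := by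
  unfold sideClosure hSum
  calc Iso 0 0 _ ((.cap, 0) :: (.cap, 2) :: (.cap, 2) :: (.pos, 1) :: (Word.shift 3 b ++
          [(.cup, 2), (.cup, 2), (.cup, 0)])) := by simpa using Iso.refl _
    Iso 0 0 _ ((.cap, 0) :: (.cap, 2) :: (.cap, 2) :: (Word.shift 3 b ++
          [(.pos, 1), (.cup, 2), (.cup, 2), (.cup, 0)])) := by
      simpa using (Iso.event_box (n := 0) (m := 0) [(.cap, 0), (.cap, 2), (.cap, 2)]
        [(.cup, 2), (.cup, 2), (.cup, 0)] hb 3 3 .pos 1 (by simp) (by simp) (by simp)).symm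
    Iso 0 0 _ ((.cap, 0) :: (.cap, 2) :: (.cap, 2) :: (Word.shift 3 b ++
          [(.pos, 1), (.cup, 2), (.cup, 0), (.cup, 0)])) := by
      have h := (Iso.move (n := 0) (m := 0) ((.cap, 0) :: (.cap, 2) :: (.cap, 2) ::
        (Word.shift 3 b ++ [(.pos, 1), (.cup, 2)])) [] (.exchange .cup .cup 0 0)
        (by simp [hb])).symm
      simpa using h
    Iso 0 0 _ ((.cap, 0) :: (.cap, 2) :: (.cap, 2) :: (Word.shift 3 b ++
          [(.pos, 1), (.cup, 0), (.cup, 0), (.cup, 0)])) := by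
      have h := (Iso.move (n := 0) (m := 0) ((.cap, 0) :: (.cap, 2) :: (.cap, 2) ::
        (Word.shift 3 b ++ [(.pos, 1)])) [(.cup, 0)] (.exchange .cup .cup 0 0)
        (by simp [hb])).symm
      simpa using h
    Iso 0 0 _ ((.cap, 0) :: (.cap, 2) :: (.cap, 2) :: (Word.shift 3 b ++
          [(.neg, 0), (.cup, 1), (.cup, 0), (.cup, 0)])) := by
      simpa using Iso.move (n := 0) (m := 0) ((.cap, 0) :: (.cap, 2) :: (.cap, 2) ::
        Word.shift 3 b) [(.cup, 0), (.cup, 0)] (.cupSlideUnder 0) (by simp [hb])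
    Iso 0 0 _ ((.cap, 0) :: (.cap, 2) :: (.cap, 2) :: (.neg, 0) :: (Word.shift 3 b ++
          [(.cup, 1), (.cup, 0), (.cup, 0)])) := by
      simpa using Iso.event_box (n := 0) (m := 0) [(.cap, 0), (.cap, 2), (.cap, 2)]
        [(.cup, 1), (.cup, 0), (.cup, 0)] hb 3 3 .neg 0 (by simp) (by simp) (by simp)
    Iso 0 0 _ ((.cap, 0) :: (.cap, 2) :: (.neg, 0) :: (.cap, 2) :: (Word.shift 3 b ++
          [(.cup, 1), (.cup, 0), (.cup, 0)])) := by
      simpa using (Iso.move (n := 0) (m := 0) [(.cap, 0), (.cap, 2)] (Word.shift 3 b ++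
        [(.cup, 1), (.cup, 0), (.cup, 0)]) (.exchange .neg .cap 0 0) (by simp [hb])).symm
    Iso 0 0 _ ((.cap, 0) :: (.neg, 0) :: (.cap, 2) :: (.cap, 2) :: (Word.shift 3 b ++
          [(.cup, 1), (.cup, 0), (.cup, 0)])) := by
      simpa using (Iso.move (n := 0) (m := 0) [(.cap, 0)] ((.cap, 2) :: (Word.shift 3 b ++
        [(.cup, 1), (.cup, 0), (.cup, 0)])) (.exchange .neg .cap 0 0) (by simp [hb])).symm
    Iso 0 0 _ ((.cap, 0) :: (.cap, 2) :: (.cap, 2) :: (Word.shift 3 b ++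
          [(.cup, 1), (.cup, 0), (.cup, 0)])) := by
      simpa using Iso.move (n := 0) (m := 0) [] ((.cap, 2) :: (.cap, 2) :: (Word.shift 3 b ++
        [(.cup, 1), (.cup, 0), (.cup, 0)])) (.capCurlNeg 0) (by simp [hb])
    Iso 0 0 _ ((.cap, 0) :: (.cap, 2) :: (.cap, 4) :: (Word.shift 3 b ++
          [(.cup, 1), (.cup, 0), (.cup, 0)])) := by
      simpa using (Iso.move (n := 0) (m := 0) [(.cap, 0)] (Word.shift 3 b ++
        [(.cup, 1), (.cup, 0), (.cup, 0)]) (.exchange .cap .cap 2 0) (by simp [hb])).symm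
    Iso 0 0 _ ((.cap, 0) :: (.cap, 2) :: (.cap, 4) :: (.cup, 1) :: (Word.shift 1 b ++
          [(.cup, 0), (.cup, 0)])) := by
      simpa using Iso.event_box (n := 0) (m := 0) [(.cap, 0), (.cap, 2), (.cap, 4)]
        [(.cup, 0), (.cup, 0)] hb 3 1 .cup 1 (by simp) (by simp) (by simp)
    Iso 0 0 _ ((.cap, 0) :: (.cap, 2) :: (.cup, 1) :: (.cap, 2) :: (Word.shift 1 b ++
          [(.cup, 0), (.cup, 0)])) := by
      simpa using (Iso.move (n := 0) (m := 0) [(.cap, 0), (.cap, 2)] (Word.shift 1 b ++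
          [(.cup, 0), (.cup, 0)]) (.exchange .cup .cap 1 1) (by simp [hb])).symm
    Iso 0 0 _ ((.cap, 0) :: (.cap, 2) :: (Word.shift 1 b ++ [(.cup, 0), (.cup, 0)])) := by
      simpa using Iso.move (n := 0) (m := 0) [(.cap, 0)] ((.cap, 2) :: (Word.shift 1 b ++
        [(.cup, 0), (.cup, 0)])) (.zagzig 1) (by simp [hb])
    Iso 0 0 _ _ := by
      simpa using Iso.move (n := 0) (m := 0) ((.cap, 0) :: (.cap, 2) :: Word.shift 1 b) []
        (.exchange .cup .cup 0 0) (by simp [hb])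

theorem sideClosure_rotate {a : Word} (ha : IsTangle a 2 2) :
    Iso 0 0 (sideClosure (rotate a)) (closureWord a) := by
  unfold sideClosure rotate closureWord
  calc Iso 0 0 _ ((.cap, 0) :: (.cap, 2) :: (.cap, 3) :: (Word.shift 2 a ++
          [(.cup, 1), (.cup, 2), (.cup, 0)])) := by simpa using Iso.refl _
    Iso 0 0 _ ((.cap, 0) :: (.cap, 2) :: (.cap, 3) :: (Word.shift 2 a ++
          [(.cup, 4), (.cup, 1), (.cup, 0)])) := by
      simpa using Iso.move (n := 0) (m := 0) ((.cap, 0) :: (.cap, 2) :: (.cap, 3) ::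
        Word.shift 2 a) [(.cup, 0)] (.exchange .cup .cup 1 1) (by simp [ha])
    Iso 0 0 _ ((.cap, 0) :: (.cap, 2) :: (.cap, 3) :: (.cup, 4) :: (Word.shift 2 a ++
          [(.cup, 1), (.cup, 0)])) := by
      simpa using Iso.box_event (n := 0) (m := 0) [(.cap, 0), (.cap, 2), (.cap, 3)]
        [(.cup, 1), (.cup, 0)] ha 2 .cup 4 (by simp) (by simp)
    Iso 0 0 _ ((.cap, 0) :: (.cap, 2) :: (Word.shift 2 a ++ [(.cup, 1), (.cup, 0)])) := by
      simpa using Iso.move (n := 0) (m := 0) [(.cap, 0), (.cap, 2)] (Word.shift 2 a ++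
        [(.cup, 1), (.cup, 0)]) (.zigzag 3) (by simp [ha])
    Iso 0 0 _ ((.cap, 0) :: (.cap, 0) :: (Word.shift 2 a ++ [(.cup, 1), (.cup, 0)])) := by
      simpa using Iso.move (n := 0) (m := 0) [] (Word.shift 2 a ++ [(.cup, 1), (.cup, 0)])
        (.exchange .cap .cap 0 0) (by simp [ha])
    Iso 0 0 _ ((.cap, 0) :: (a ++ [(.cap, 0), (.cup, 1), (.cup, 0)])) := by
      simpa using (Iso.event_box (n := 0) (m := 0) [(.cap, 0)] [(.cup, 1), (.cup, 0)] ha 0 2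
        .cap 0 (by simp) (by simp) (by simp)).symm
    Iso 0 0 _ _ := by
      simpa using Iso.move (n := 0) (m := 0) ((.cap, 0) :: a) [(.cup, 0)] (.zigzag 0)
        (by simp [ha])

theorem diagram_eq (T : BinTree) :
    treeWord (.node () T .nil) ++ Word.flip (treeWord (rightComb (T.numNodes + 1))) =
      (.cap, 0) :: (.cap, 1) :: (.neg, 2) :: (Word.shift 1 (graft T) ++ [(.cup, 0)]) := by
  simp [treeWord, branchWord, graft, Word.flip_cons, Word.flip_shift, Event.flip, combWord]

/-- The top caret closes the graft of `T` to the side closure of a positive crossing next to the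
rotated tangle of `T`. The crossing is a curl, and the side closure of a rotated tangle is the
ordinary closure of the tangle. -/
theorem diagram_iso_closureWord (T : BinTree) :
    Iso 0 0 (treeWord (.node () T .nil) ++ Word.flip (treeWord (rightComb (T.numNodes + 1))))
      (closureWord (treeTangle T)) := by
  rw [diagram_eq]
  have ta := isTangle_treeTangle T
  have hx := ta.hSum isTangle_neg
  have hg := graft_iso T
  have hxa := Iso.pos_append_hSum_neg ta
  generalize treeTangle T = a at *
  generalize hSum a [(.neg, 0)] = x at *
  have tb := ta.rotate
  calc Iso 0 0 _ ((.cap, 0) :: (.cap, 1) :: (.neg, 2) ::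
          (Word.shift 1 x ++ [(.cup, 2), (.cup, 0)])) := by
        simpa using (hg.shift 1 0).ctx (n := 0) (m := 0) [(.cap, 0), (.cap, 1), (.neg, 2)]
          [(.cup, 0)] (by simp) (by simp)
    Iso 0 0 _ ((.cap, 0) :: (.cap, 2) :: (.pos, 1) ::
          (Word.shift 1 x ++ [(.cup, 2), (.cup, 0)])) := by
        simpa using Iso.move (n := 0) (m := 0) [(.cap, 0)]
          (Word.shift 1 x ++ [(.cup, 2), (.cup, 0)]) (.capSlideUnder 1) (by simp [hx])
    Iso 0 0 _ (sideClosure (hSum [(.pos, 0)] (rotate a))) := by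
        simpa [sideClosure] using (hxa.shift 1 1).ctx (n := 0) (m := 0) [(.cap, 0), (.cap, 2)]
          [(.cup, 2), (.cup, 0)] (by simp) (by simp)
    Iso 0 0 _ _ := (sideClosure_pos_hSum tb).trans (sideClosure_rotate ta)

/-! ### Positive elements -/

theorem numLeaves_rightComb (n : ℕ) : (rightComb n).numLeaves = n + 1 := by
  rw [BinaryTree.numLeaves_eq_numNodes_succ, numNodes_rightComb]

theorem addCaret_ne_nil (T : BinTree) (i : ℕ) : addCaret T i ≠ .nil := by
  cases T with
  | nil => simp [addCaret]
  | node _ l r => rw [addCaret]; split_ifs <;> simp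

theorem numLeaves_addCaret (T : BinTree) (i : ℕ) :
    (addCaret T i).numLeaves = T.numLeaves + 1 := by
  induction T generalizing i with
  | nil => simp [addCaret, BinaryTree.numLeaves]
  | node _ l r ihl ihr =>
    rw [addCaret]
    split_ifs
    · simp only [BinaryTree.numLeaves, ihl]; omega
    · simp only [BinaryTree.numLeaves, ihr]; omega

theorem exists_addCaret (T : BinTree) (h : T ≠ .nil) :
    ∃ S i, i < S.numLeaves ∧ addCaret S i = T := by
  induction T with
  | nil => exact absurd rfl h
  | node _ l r ihl ihr =>
    by_cases hl : l = .nil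
    · by_cases hr : r = .nil
      · subst hl hr
        exact ⟨.nil, 0, by simp [BinaryTree.numLeaves], rfl⟩
      · obtain ⟨S, i, hi, rfl⟩ := ihr hr
        refine ⟨.node () l S, l.numLeaves + i, by simp only [BinaryTree.numLeaves]; omega, ?_⟩
        rw [addCaret, if_neg (by omega), Nat.add_sub_cancel_left]
    · obtain ⟨S, i, hi, rfl⟩ := ihl hl
      refine ⟨.node () S r, i, by simp only [BinaryTree.numLeaves]; omega, ?_⟩
      rw [addCaret, if_pos hi]

theorem addCaret_rightComb_last (n : ℕ) : addCaret (rightComb n) n = rightComb (n + 1) := by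
  induction n with
  | zero => rfl
  | succ n ih =>
    rw [rightComb, addCaret, if_neg (by simp [BinaryTree.numLeaves])]
    simp [BinaryTree.numLeaves, ih, rightComb]

/-- A caret can be added to a right comb only at its last leaf if the result is to be a right
comb. -/
theorem eq_last_of_addCaret_eq_rightComb {T : BinTree} {i m : ℕ} (hi : i < T.numLeaves)
    (h : addCaret T i = rightComb m) : i + 1 = T.numLeaves := by
  induction T generalizing i m with
  | nil => simp only [BinaryTree.numLeaves] at hi ⊢; omega
  | node _ l r ihl ihr =>
    cases m with
    | zero => exact absurd h (addCaret_ne_nil _ _)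
    | succ m =>
      rw [addCaret, rightComb] at h
      split_ifs at h with hil
      · exact absurd (BinaryTree.node.inj h).2.1 (addCaret_ne_nil _ _)
      · simp only [BinaryTree.numLeaves] at hi ⊢
        have := ihr (by omega) (BinaryTree.node.inj h).2.2
        omega

theorem addCaret_last_ne {T L : BinTree} (hL : L ≠ .nil) {i : ℕ} (hi : i + 1 = T.numLeaves) :
    addCaret T i ≠ .node () L .nil := by
  intro h
  cases T with
  | nil => exact hL (BinaryTree.node.inj h).2.1.symm
  | node _ l r =>
    rw [addCaret, if_neg] at h
    · exact addCaret_ne_nil _ _ (BinaryTree.node.inj h).2.2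
    · simp only [BinaryTree.numLeaves] at hi
      have := r.numLeaves_pos
      omega

/-- The right comb has a caret only at its last two leaves, where the top tree has none. -/
theorem isReduced_of_ne_nil {L : BinTree} (hL : L ≠ .nil) {m : ℕ}
    (h : (BinaryTree.node () L .nil).numLeaves = (rightComb m).numLeaves) :
    TreePair.IsReduced ⟨.node () L .nil, rightComb m, h⟩ := by
  rintro ⟨q, i, hi, h1, h2⟩
  rw [q.numLeaves_eq] at hi
  have := eq_last_of_addCaret_eq_rightComb hi h2.symm
  exact addCaret_last_ne hL (this.trans q.numLeaves_eq.symm) h1.symm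

theorem toF_addCaret {S T : BinTree} (h : S.numLeaves = T.numLeaves) {i : ℕ}
    (hi : i < S.numLeaves) (h' : (addCaret S i).numLeaves = (addCaret T i).numLeaves) :
    TreePair.toF ⟨addCaret S i, addCaret T i, h'⟩ = TreePair.toF ⟨S, T, h⟩ :=
  (Quot.sound ⟨i, hi, rfl, rfl⟩).symm

theorem addCaret_node_nil (T : BinTree) (i : ℕ) :
    addCaret (.node () .nil T) (i + 1) = .node () .nil (addCaret T i) := by
  rw [addCaret, if_neg (by simp [BinaryTree.numLeaves])]
  simp [BinaryTree.numLeaves]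

theorem generatorTop_eq (i : ℕ) : generatorTop i = addCaret (rightComb (i + 1)) i := by
  induction i with
  | zero => rfl
  | succ i ih =>
    rw [generatorTop, ih, ← addCaret_node_nil]
    rfl

theorem addCaret_comm_last (i k : ℕ) :
    addCaret (addCaret (rightComb (i + k + 1)) i) (i + k + 2) =
      addCaret (rightComb (i + k + 2)) i := by
  induction i with
  | zero =>
    have h := addCaret_rightComb_last k
    simp [rightComb, addCaret, BinaryTree.numLeaves, h]
  | succ i ih =>
    have e1 : i + 1 + k + 1 = i + k + 1 + 1 := by omega
    have e2 : i + 1 + k + 2 = i + k + 2 + 1 := by omega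
    rw [e1, e2]
    change addCaret (addCaret (.node () .nil (rightComb (i + k + 1))) (i + 1)) (i + k + 2 + 1) =
      addCaret (.node () .nil (rightComb (i + k + 2))) (i + 1)
    rw [addCaret_node_nil, addCaret_node_nil, addCaret_node_nil, ih]

/-- The generator `x i` is represented by the right combs of all sufficiently large sizes, the top
one having one caret less and an additional caret at the leaf `i` instead. -/
theorem isPositive_addCaret_rightComb (i k : ℕ)
    (h : (addCaret (rightComb (i + k + 1)) i).numLeaves = (rightComb (i + k + 2)).numLeaves) :
    IsPositive (TreePair.toF ⟨addCaret (rightComb (i + k + 1)) i, rightComb (i + k + 2), h⟩) := by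
  induction k with
  | zero =>
    have := IsPositive.generator i
    unfold Knot.generator at this
    simpa only [generatorTop_eq] using this
  | succ k ih =>
    have h0 :
        (addCaret (rightComb (i + k + 1)) i).numLeaves = (rightComb (i + k + 2)).numLeaves := by
      simp [numLeaves_addCaret, numLeaves_rightComb]
    have := ih h0
    rw [← toF_addCaret h0 (i := i + k + 2) (by simp [numLeaves_addCaret, numLeaves_rightComb])
      (by simp [numLeaves_addCaret, numLeaves_rightComb])] at this
    simpa only [addCaret_comm_last, addCaret_rightComb_last, ← Nat.add_assoc] using this

/-- A tree with a caret at the leaf `i` is the product of the pair without that caret and of the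
generator `x i`; a caret at the last leaf is opposed by one of the comb. -/
theorem isPositive_rightComb (T : BinTree) (n : ℕ) (h : T.numLeaves = (rightComb n).numLeaves) :
    IsPositive (TreePair.toF ⟨T, rightComb n, h⟩) := by
  induction n generalizing T with
  | zero =>
    cases T with
    | nil => exact .one .nil
    | node _ l r =>
      simp only [rightComb, BinaryTree.numLeaves] at h
      have := l.numLeaves_pos
      have := r.numLeaves_pos
      omega
  | succ n ih =>
    obtain ⟨S, i, hi, rfl⟩ := exists_addCaret T (by
      rintro rfl
      simp [numLeaves_rightComb, BinaryTree.numLeaves] at h)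
    have hS : S.numLeaves = (rightComb n).numLeaves := by
      simpa [numLeaves_addCaret, numLeaves_rightComb] using h
    have hSi : (addCaret S i).numLeaves = (addCaret (rightComb n) i).numLeaves := by
      simp [numLeaves_addCaret, hS]
    have h1 := ih S hS
    rw [← toF_addCaret hS hi hSi] at h1
    have hin : i ≤ n := by
      rw [hS, numLeaves_rightComb] at hi
      omega
    rcases hin.eq_or_lt with rfl | hin
    · simpa only [addCaret_rightComb_last] using h1
    · obtain ⟨k, rfl⟩ := Nat.exists_eq_add_of_lt hin
      exact .mul hSi _ h1 (isPositive_addCaret_rightComb i k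
        (by simp [numLeaves_addCaret, numLeaves_rightComb]))

end Knot

theorem corollary2 : Knot.positiveArborescentLinks ⊆ Knot.positiveThompsonLinks := by
  rintro _ ⟨t, _, rfl⟩
  obtain ⟨x, hx⟩ := Knot.exists_algTangle_hTangle t
  obtain ⟨T, hT, hTx⟩ := x.realizable.exists_ne_nil
  rw [hx] at hTx
  have hn : (BinaryTree.node () T .nil).numLeaves =
      (Knot.rightComb (T.numNodes + 1)).numLeaves := by
    rw [Knot.numLeaves_rightComb, BinaryTree.numLeaves, T.numLeaves_eq_numNodes_succ]
    rfl
  -- a caret above `T`, with nothing on its right, makes the pair reduced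
  refine ⟨⟨.node () T .nil, Knot.rightComb (T.numNodes + 1), hn⟩, Knot.isReduced_of_ne_nil hT hn,
    Knot.isPositive_rightComb _ _ hn, Knot.Iso.link_eq ?_⟩
  refine (Knot.diagram_iso_closureWord T).trans ?_
  simpa [Knot.closureWord] using
    (hTx.shift 0 0).ctx (n := 0) (m := 0) [(.cap, 0)] [(.cup, 0)] (by simp) (by simp)
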